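/- Let $q\in\mathbb C$ with $0<|q|<1$. Write $(a;q)_n=\prod_{k=0}^{n-1}(1-aq^k)$, $(a;q)_\infty=\prod_{k\ge0}(1-aq^k)$, $(a_1,\dots,a_m;q)_n=(a_1;q)_n\cdots(a_m;q)_n$ for $0\le n\le\infty$, and $J_k=(q^k;q^k)_\infty$. Put $$F_8(z,q)=\sum_{n=0}^{\infty}\frac{(-1)^n(q;q^2)_n\,q^{(n+1)^2}}{(zq,q/z;q^2)_{n+1}}.$$ (i) For every $z\in\mathbb C\setminus\{0,1\}$ that is not an odd integral power of $q$ (so that no denominator in $F_8(z,q)$ vanishes), the series $F_8(z,q)$ converges absolutely and $$(z^2q^2,q^2/z^2,q^4;q^4)_\infty\,F_8(z,q)=\sum_{k=-\infty}^{\infty}\frac{(-1)^{k-1}q^{2k^2}}{1+q^{4k-1}}\cdot\frac{z^{1-2k}-z^{2k}}{1-z},$$ where the bilateral series converges absolutely. (ii) For an integer $N>0$ let $H(N)$ be the Hurwitz class number: the number of $\mathrm{SL}_2(\mathbb Z)$-classes of (not necessarily primitive) positive definite integral binary quadratic forms $ax^2+bxy+cy^2$ of discriminant $b^2-4ac=-N$,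 where classes that contain a multiple of $x^2+y^2$ or of $x^2+xy+y^2$ are counted with weight $1/2$ or $1/3$, respectively. Let $\mathscr F_{8,-1}(q)=\sum_{n=1}^{\infty}H(8n-1)q^n$. This series converges absolutely, the left-hand side of the identity in (i) tends to $\frac{J_2^2}{J_4}\mathscr F_{8,-1}(q)$ as $z\to1$, $z\neq1$, and $$\frac{J_2^2}{J_4}\,\mathscr F_{8,-1}(q)=\sum_{k=-\infty}^{\infty}\frac{(-1)^{k-1}(4k-1)\,q^{2k^2}}{1+q^{4k-1}},$$ where the bilateral series converges absolutely. -/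

import Mathlib

open Filter Topology

noncomputable section

/-- The finite `q`-Pochhammer symbol `(a; q)_n = ∏_{k=0}^{n-1} (1 - a q^k)`. -/
def qPoch (a q : ℂ) (n : ℕ) : ℂ := ∏ k ∈ Finset.range n, (1 - a * q ^ k)

/-- The infinite `q`-Pochhammer symbol `(a; q)_∞ = ∏_{k=0}^∞ (1 - a q^k)`. -/
def qPochInf (a q : ℂ) : ℂ := ∏' k : ℕ, (1 - a * q ^ k)

/-- `J_k = (q^k; q^k)_∞`. -/
def qJ (k : ℕ) (q : ℂ) : ℂ := qPochInf (q ^ k) (q ^ k)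

/-- The `n`-th term of the series that defines `F_8(z, q)`. -/
def F8Term (z q : ℂ) (n : ℕ) : ℂ :=
  (-1) ^ n * qPoch q (q ^ 2) n * q ^ ((n + 1) ^ 2) /
    (qPoch (z * q) (q ^ 2) (n + 1) * qPoch (q / z) (q ^ 2) (n + 1))

/-- `F_8(z, q) = ∑_{n ≥ 0} (-1)^n (q; q^2)_n q^{(n+1)^2} / (zq, q/z; q^2)_{n+1}`. -/
def F8 (z q : ℂ) : ℂ := ∑' n : ℕ, F8Term z q n

/-- The product `(z^2 q^2, q^2 / z^2, q^4; q^4)_∞`. -/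
def thetaProd (z q : ℂ) : ℂ :=
  qPochInf (z ^ 2 * q ^ 2) (q ^ 4) * qPochInf (q ^ 2 / z ^ 2) (q ^ 4) * qPochInf (q ^ 4) (q ^ 4)

/-- An integral binary quadratic form `a x^2 + b x y + c y^2` (not necessarily primitive). -/
@[ext]
structure BinForm where
  a : ℤ
  b : ℤ
  c : ℤ

namespace BinForm

/-- The value `a x^2 + b x y + c y^2`. -/
def eval (f : BinForm) (x y : ℤ) : ℤ := f.a * x ^ 2 + f.b * x * y + f.c * y ^ 2

/-- The discriminant `b^2 - 4 a c`. -/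
def disc (f : BinForm) : ℤ := f.b ^ 2 - 4 * f.a * f.c

/-- Positive definiteness. -/
def IsPosDef (f : BinForm) : Prop := ∀ x y : ℤ, (x ≠ 0 ∨ y ≠ 0) → 0 < f.eval x y

/-- Proper equivalence: `g` arises from `f` by a substitution in `SL₂(ℤ)`. -/
def Equivalent (f g : BinForm) : Prop :=
  ∃ γ : Matrix.SpecialLinearGroup (Fin 2) ℤ, ∀ x y : ℤ,
    g.eval x y = f.eval (γ.1 0 0 * x + γ.1 0 1 * y) (γ.1 1 0 * x + γ.1 1 1 * y)

theorem Equivalent.refl (f : BinForm) : Equivalent f f :=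
  ⟨1, fun x y => by simp⟩

theorem Equivalent.symm {f g : BinForm} (h : Equivalent f g) : Equivalent g f := by
  obtain ⟨γ, hγ⟩ := h
  refine ⟨γ⁻¹, fun x y => ?_⟩
  have hd : γ.1 0 0 * γ.1 1 1 - γ.1 0 1 * γ.1 1 0 = 1 := by
    rw [← Matrix.det_fin_two]; exact γ.2
  rw [hγ]
  simp only [Matrix.SpecialLinearGroup.SL2_inv_expl, Matrix.cons_val',
    Matrix.cons_val_zero, Matrix.cons_val_one, Matrix.cons_val_fin_one]
  congr 1
  · linear_combination (-x) * hd
  · linear_combination (-y) * hd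

theorem Equivalent.trans {f g h : BinForm} (h₁ : Equivalent f g) (h₂ : Equivalent g h) :
    Equivalent f h := by
  obtain ⟨γ, hγ⟩ := h₁
  obtain ⟨δ, hδ⟩ := h₂
  refine ⟨γ * δ, fun x y => ?_⟩
  rw [hδ, hγ]
  simp only [Matrix.SpecialLinearGroup.coe_mul, Matrix.mul_apply, Fin.sum_univ_two]
  congr 1 <;> ring

end BinForm

/-- The positive definite integral binary quadratic forms of discriminant `-N`. -/
def PosForm (N : ℕ) : Type := {f : BinForm // f.IsPosDef ∧ f.disc = -(N : ℤ)}

/-- Proper equivalence of positive definite forms of discriminant `-N`. -/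
def posFormSetoid (N : ℕ) : Setoid (PosForm N) where
  r f g := BinForm.Equivalent f.1 g.1
  iseqv := ⟨fun f => BinForm.Equivalent.refl f.1, fun h => h.symm, fun h₁ h₂ => h₁.trans h₂⟩

/-- The classes of positive definite forms of discriminant `-N`. -/
def FormClass (N : ℕ) : Type := Quotient (posFormSetoid N)

open Classical in
/-- The weight of a class: `1/2` if it contains a multiple of `x^2 + y^2`, `1/3` if it contains
a multiple of `x^2 + x y + y^2`, and `1` otherwise. -/
def FormClass.weight {N : ℕ} (C : FormClass N) : ℚ :=
  if ∃ f : PosForm N, Quotient.mk (posFormSetoid N) f = C ∧ ∃ m : ℤ, f.1 = ⟨m, 0, m⟩ then 1 / 2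
  else if ∃ f : PosForm N, Quotient.mk (posFormSetoid N) f = C ∧ ∃ m : ℤ, f.1 = ⟨m, m, m⟩ then 1 / 3
  else 1

/-- The Hurwitz class number `H(N)`: `H(0) = -1/12`, and for `N > 0` the weighted number of classes
of positive definite forms of discriminant `-N` (there are none if `N ≡ 1, 2 mod 4`). -/
def hurwitzH (N : ℕ) : ℚ :=
  if N = 0 then -1 / 12 else ∑ᶠ C : FormClass N, C.weight

/-- The terms of `𝓕_{8,-1}(q) = ∑_{n ≥ 1} H(8n - 1) q^n`, indexed by `n - 1`. -/
def scriptF8Term (q : ℂ) (n : ℕ) : ℂ := (hurwitzH (8 * (n + 1) - 1) : ℂ) * q ^ (n + 1)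

/-- The generating function `𝓕_{8,-1}(q) = ∑_{n ≥ 1} H(8n - 1) q^n`. -/
def scriptF8 (q : ℂ) : ℂ := ∑' n : ℕ, scriptF8Term q n

end

noncomputable section

/-! Write θ(z) for `thetaProd z q`.

For (i), a telescoping certificate gives `F8` a first-order inhomogeneous equation under z ↦ q²z
(`F8_sq_mul`). The factor θ(z) cancels all poles away from the origin, which leaves `thetaF8`, and
(1 - z) `thetaF8` satisfies the same equation as `appellSum`, the bilateral series times 1 - z.
Their difference h is analytic on ℂ ∖ {0} with h(q²z) = -q h(z). Lifted by the exponential and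
suitably twisted, h becomes antiperiodic in two independent directions, so Liouville's theorem
forces h = 0 (`eq_zero_of_quasiperiodic`).

For (ii), the limit at z = 1 is minus the derivative of (1 - z) `thetaF8` there, and differentiating
`appellSum` termwise turns it into the stated bilateral series (`hasSum_derivTerm_thetaF8`). That
this series is θ(1) times the class number series is shown independently of `F8`. Each class of
discriminant 1 - 8n has weight 1 and exactly one representative with a, c even, b odd and 0 < b < 2
min(a, c). Hence H(8n - 1) counts two families of triples (l, k, r), and geometric summation over r
gives ∑_{j≥0} T_j W_j with T_j = ∑_{l+k=j} q^{2lk} and W_j = `lambertW q j`.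

Next, θ(1) T_j = 2 ∑_k (-1)^k q^{2k²} / (1 + q^{2j-4k}), because both sides obey the same two-step
recurrence (`appellY_eq_mul_thetaT`). The right side makes sense for negative j, and its product
with W_j is symmetric under j ↦ -2 - j, so half the sum over all j ∈ ℤ may be taken. After
interchanging the sums, partial fractions evaluate the sum over j; the linear factors 4k + 1 and 4k
+ 3 count index shifts in regularized sums (`hasSum_inv_mul_lambertW`). -/

/-! ### q-Pochhammer symbols -/

theorem qPoch_zero (a p : ℂ) : qPoch a p 0 = 1 := by simp [qPoch]

theorem qPoch_succ (a p : ℂ) (n : ℕ) : qPoch a p (n + 1) = qPoch a p n * (1 - a * p ^ n) :=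
  Finset.prod_range_succ _ _

theorem qPoch_succ' (a p : ℂ) (n : ℕ) : qPoch a p (n + 1) = (1 - a) * qPoch (a * p) p n := by
  simp only [qPoch, Finset.prod_range_succ']
  rw [mul_comm]
  simp [pow_succ', mul_assoc]

theorem summable_norm_mul_pow (a : ℂ) {p : ℂ} (hp : ‖p‖ < 1) :
    Summable fun k : ℕ => ‖-(a * p ^ k)‖ := by
  simpa using (summable_geometric_of_lt_one (norm_nonneg p) hp).mul_left ‖a‖

theorem multipliable_qPochInf (a : ℂ) {p : ℂ} (hp : ‖p‖ < 1) :
    Multipliable fun k : ℕ => 1 - a * p ^ k := by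
  simpa [sub_eq_add_neg] using multipliable_one_add_of_summable (summable_norm_mul_pow a hp)

theorem tendsto_qPoch (a : ℂ) {p : ℂ} (hp : ‖p‖ < 1) :
    Tendsto (qPoch a p) atTop (𝓝 (qPochInf a p)) :=
  (multipliable_qPochInf a hp).hasProd.tendsto_prod_nat

theorem qPochInf_eq_mul (a : ℂ) {p : ℂ} (hp : ‖p‖ < 1) (n : ℕ) :
    qPochInf a p = qPoch a p n * qPochInf (a * p ^ n) p := by
  have h : Multipliable fun k : ℕ => 1 - a * p ^ (k + n) := by
    convert multipliable_qPochInf (a * p ^ n) hp using 2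
    ring
  have h2 := h.prod_mul_tprod_nat_mul' (f := fun k : ℕ => 1 - a * p ^ k)
  rw [qPochInf, ← h2, qPoch, qPochInf]
  congr 1
  exact tprod_congr fun k => by ring

theorem qPochInf_ne_zero {a p : ℂ} (hp : ‖p‖ < 1) (ha : ∀ k : ℕ, a * p ^ k ≠ 1) :
    qPochInf a p ≠ 0 := by
  have := tprod_one_add_ne_zero_of_summable (f := fun k : ℕ => -(a * p ^ k))
    (fun k h => ha k (by linear_combination -h)) (summable_norm_mul_pow a hp)
  simpa [qPochInf, sub_eq_add_neg] using this

theorem qPoch_ne_zero {a p : ℂ} {n : ℕ} (ha : ∀ k < n, a * p ^ k ≠ 1) : qPoch a p n ≠ 0 :=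
  Finset.prod_ne_zero_iff.2 fun k hk h => ha k (Finset.mem_range.1 hk) (by linear_combination -h)

theorem differentiable_qPochInf {p : ℂ} (hp : ‖p‖ < 1) :
    Differentiable ℂ fun x => qPochInf x p := by
  intro x
  have hu : Summable fun k : ℕ => (‖x‖ + 1) * ‖p‖ ^ k :=
    (summable_geometric_of_lt_one (norm_nonneg p) hp).mul_left _
  have h := hu.hasProdLocallyUniformlyOn_nat_one_add (f := fun k x => -(x * p ^ k))
    (K := Metric.ball (0 : ℂ) (‖x‖ + 1)) Metric.isOpen_ball
    (.of_forall fun k y hy => by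
      have : ‖y‖ ≤ ‖x‖ + 1 := by simpa using (mem_ball_zero_iff.1 hy).le
      simpa using mul_le_mul_of_nonneg_right this (by positivity)) (fun k => by fun_prop)
  have h2 : DifferentiableOn ℂ (fun x : ℂ => ∏' k : ℕ, (1 + -(x * p ^ k)))
      (Metric.ball (0 : ℂ) (‖x‖ + 1)) := by
    refine h.differentiableOn (Eventually.of_forall fun s => ?_) Metric.isOpen_ball
    fun_prop
  have h3 := h2.differentiableAt (Metric.isOpen_ball.mem_nhds (x := x) (by simp))
  simpa [qPochInf, sub_eq_add_neg] using h3

theorem exists_norm_qPochInf_le {p : ℂ} (hp : ‖p‖ < 1) (R : ℝ) :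
    ∃ C, 0 ≤ C ∧ ∀ x : ℂ, ‖x‖ ≤ R → ‖qPochInf x p‖ ≤ C := by
  obtain ⟨C, hC⟩ := (isCompact_closedBall (0 : ℂ) R).exists_bound_of_continuousOn
    (differentiable_qPochInf hp).continuous.continuousOn
  exact ⟨|C|, abs_nonneg _, fun x hx => (hC x (by simpa using hx)).trans (le_abs_self C)⟩

theorem norm_sq_lt_one {p : ℂ} (hp : ‖p‖ < 1) {n : ℕ} (hn : n ≠ 0) : ‖p ^ n‖ < 1 := by
  rw [norm_pow]; exact pow_lt_one₀ (norm_nonneg _) hp hn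

theorem qPochInf_sq (x : ℂ) {p : ℂ} (hp : ‖p‖ < 1) :
    qPochInf (x ^ 2) (p ^ 2) = qPochInf x p * qPochInf (-x) p := by
  rw [qPochInf, qPochInf, qPochInf,
    ← (multipliable_qPochInf x hp).tprod_mul (multipliable_qPochInf (-x) hp)]
  exact tprod_congr fun k => by ring

theorem qPochInf_even_odd (a : ℂ) {p : ℂ} (hp : ‖p‖ < 1) :
    qPochInf a p = qPochInf a (p ^ 2) * qPochInf (a * p) (p ^ 2) := by
  have hp2 : ‖p ^ 2‖ < 1 := norm_sq_lt_one hp two_ne_zero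
  rw [qPochInf, ← tprod_even_mul_odd (f := fun k => 1 - a * p ^ k)]
  · simp only [qPochInf]
    congr 1 <;> exact tprod_congr fun k => by ring
  · convert multipliable_qPochInf a hp2 using 2; ring
  · convert multipliable_qPochInf (a * p) hp2 using 2; ring

/-! ### Majorants with Gaussian decay -/

theorem summable_nat_pow_sq_mul_pow {r : ℝ} (h0 : 0 ≤ r) (h1 : r < 1) (M : ℝ) :
    Summable fun n : ℕ => r ^ n ^ 2 * M ^ n := by
  have ht : Tendsto (fun n : ℕ => r ^ n * |M|) atTop (𝓝 0) := by
    simpa using (tendsto_pow_atTop_nhds_zero_of_lt_one h0 h1).mul_const |M|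
  have hev : ∀ᶠ n : ℕ in atTop, r ^ n * |M| ≤ 1 / 2 := ht.eventually_le_const (by norm_num)
  refine (summable_geometric_of_lt_one (r := 1 / 2) (by norm_num) (by norm_num)).of_norm_bounded_eventually_nat ?_
  filter_upwards [hev] with n hn
  have : ‖r ^ n ^ 2 * M ^ n‖ = (r ^ n * |M|) ^ n := by
    rw [norm_mul, norm_pow, norm_pow, Real.norm_eq_abs, Real.norm_eq_abs, abs_of_nonneg h0]
    ring
  rw [this]
  exact pow_le_pow_left₀ (by positivity) hn n

theorem summable_int_pow_sq_mul_pow {r : ℝ} (h0 : 0 ≤ r) (h1 : r < 1) (M : ℝ) :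
    Summable fun k : ℤ => r ^ k.natAbs ^ 2 * M ^ k.natAbs := by
  have h := summable_nat_pow_sq_mul_pow h0 h1 M
  exact Summable.of_nat_of_neg (by simpa using h) (by simpa using h)

theorem zpow_sq_eq (x : ℂ) (k : ℤ) : x ^ (k ^ 2) = x ^ (k.natAbs ^ 2) := by
  rw [← Int.natAbs_sq]; exact_mod_cast rfl

theorem norm_zpow_le {w : ℂ} {M : ℝ} (h1 : ‖w‖ ≤ M) (h2 : ‖w‖⁻¹ ≤ M) (k : ℤ) :
    ‖w ^ k‖ ≤ M ^ k.natAbs := by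
  rcases Int.natAbs_eq k with h | h
  · conv_lhs => rw [h]
    rw [zpow_natCast, norm_pow]
    exact pow_le_pow_left₀ (norm_nonneg _) h1 _
  · conv_lhs => rw [h]
    rw [zpow_neg, zpow_natCast, norm_inv, norm_pow, ← inv_pow]
    exact pow_le_pow_left₀ (by positivity) h2 _

/-! ### The Jacobi triple product -/

/-- The reciprocal `1 / (p; p)_m`, extended by zero to negative `m`. -/
def invQPoch (p : ℂ) (m : ℤ) : ℂ := if 0 ≤ m then (qPoch p p m.toNat)⁻¹ else 0

theorem qPoch_self_ne_zero {p : ℂ} (hp : ‖p‖ < 1) (n : ℕ) : qPoch p p n ≠ 0 :=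
  qPoch_ne_zero fun k _ h => by
    have h1 := norm_sq_lt_one hp (Nat.succ_ne_zero k)
    rw [Nat.succ_eq_add_one, pow_succ', h] at h1
    simp at h1

theorem qPochInf_self_ne_zero {p : ℂ} (hp : ‖p‖ < 1) : qPochInf p p ≠ 0 :=
  qPochInf_ne_zero hp fun k h => by
    have h1 := norm_sq_lt_one hp (Nat.succ_ne_zero k)
    rw [Nat.succ_eq_add_one, pow_succ', h] at h1
    simp at h1

theorem invQPoch_natCast (p : ℂ) (n : ℕ) : invQPoch p n = (qPoch p p n)⁻¹ := by
  simp [invQPoch]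

/-- At `m = 0` the factor `1 - p ^ 0` vanishes, in agreement with the extension by zero. The
recurrence thus holds on all of ℤ and the finite triple product needs no boundary cases. -/
theorem invQPoch_sub_one {p : ℂ} (hp : ‖p‖ < 1) (m : ℤ) :
    invQPoch p (m - 1) = (1 - p ^ m) * invQPoch p m := by
  rcases lt_trichotomy m 0 with h | h | h
  · simp [invQPoch, show ¬ (0 ≤ m) by omega, show ¬ (1 ≤ m) by omega]
  · subst h; simp [invQPoch]
  · obtain ⟨n, rfl⟩ : ∃ n : ℕ, m = n + 1 := ⟨(m - 1).toNat, by omega⟩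
    have h1 : ((n : ℤ) + 1) = ((n + 1 : ℕ) : ℤ) := by push_cast; ring
    rw [add_sub_cancel_right, invQPoch_natCast, h1, invQPoch_natCast, zpow_natCast, qPoch_succ]
    have h2 := qPoch_self_ne_zero hp n
    have h3 := qPoch_self_ne_zero hp (n + 1)
    rw [qPoch_succ, mul_ne_zero_iff] at h3
    rw [pow_succ']
    field_simp [h3.2]

theorem exists_norm_invQPoch_le {p : ℂ} (hp : ‖p‖ < 1) :
    ∃ C, 0 ≤ C ∧ ∀ m, ‖invQPoch p m‖ ≤ C := by
  have ht : Tendsto (fun n => (qPoch p p n)⁻¹) atTop (𝓝 (qPochInf p p)⁻¹) :=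
    (tendsto_qPoch p hp).inv₀ (qPochInf_self_ne_zero hp)
  obtain ⟨C, hC⟩ := (Metric.isBounded_range_of_tendsto _ ht).exists_norm_le
  have hC0 : 0 ≤ C := (norm_nonneg _).trans (hC _ ⟨0, rfl⟩)
  refine ⟨C, hC0, fun m => ?_⟩
  unfold invQPoch
  split_ifs
  · exact hC _ ⟨_, rfl⟩
  · simpa using hC0

/-- The coefficients of the finite form of the triple product identity. -/
def tripleCoeff (Q : ℂ) (n : ℕ) (k : ℤ) : ℂ :=
  (-1) ^ k * Q ^ (k ^ 2) * qPoch (Q ^ 2) (Q ^ 2) (2 * n) *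
    (invQPoch (Q ^ 2) (n - k) * invQPoch (Q ^ 2) (n + k))

/-- This is the comparison of coefficients of w^k when the product is multiplied by (1 -
wQ^{2n+1})(1 - Q^{2n+1}/w). -/
theorem tripleCoeff_succ {Q : ℂ} (hQ0 : Q ≠ 0) (hQ : ‖Q‖ < 1) (n : ℕ) (k : ℤ) :
    tripleCoeff Q (n + 1) k = (1 + Q ^ 2 * (Q ^ 2) ^ (2 * n)) * tripleCoeff Q n k -
      Q * (Q ^ 2) ^ n * (tripleCoeff Q n (k - 1) + tripleCoeff Q n (k + 1)) := by
  have hp := norm_sq_lt_one hQ two_ne_zero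
  set x := invQPoch (Q ^ 2) ((n : ℤ) + 1 - k) with hx
  set y := invQPoch (Q ^ 2) ((n : ℤ) + 1 + k) with hy
  have e1 : invQPoch (Q ^ 2) ((n : ℤ) - k) = (1 - (Q ^ 2) ^ ((n : ℤ) + 1 - k)) * x := by
    rw [hx, ← invQPoch_sub_one hp]; congr 1; ring
  have e2 : invQPoch (Q ^ 2) ((n : ℤ) + k) = (1 - (Q ^ 2) ^ ((n : ℤ) + 1 + k)) * y := by
    rw [hy, ← invQPoch_sub_one hp]; congr 1; ring
  have e3 : invQPoch (Q ^ 2) ((n : ℤ) - (k + 1)) =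
      (1 - (Q ^ 2) ^ ((n : ℤ) - k)) * ((1 - (Q ^ 2) ^ ((n : ℤ) + 1 - k)) * x) := by
    rw [← e1, ← invQPoch_sub_one hp]; congr 1; ring
  have e4 : invQPoch (Q ^ 2) ((n : ℤ) + (k - 1)) =
      (1 - (Q ^ 2) ^ ((n : ℤ) + k)) * ((1 - (Q ^ 2) ^ ((n : ℤ) + 1 + k)) * y) := by
    rw [← e2, ← invQPoch_sub_one hp]; congr 1; ring
  have e5 : invQPoch (Q ^ 2) ((n : ℤ) - (k - 1)) = x := by rw [hx]; congr 1; ring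
  have e6 : invQPoch (Q ^ 2) ((n : ℤ) + (k + 1)) = y := by rw [hy]; congr 1; ring
  simp only [tripleCoeff]
  rw [e1, e2, e3, e4, e5, e6]
  push_cast
  rw [← hx, ← hy, show 2 * (n + 1) = 2 * n + 1 + 1 by ring, qPoch_succ, qPoch_succ,
    show (k - 1) ^ 2 = k ^ 2 + 1 - (k + k) by ring, show (k + 1) ^ 2 = k ^ 2 + 1 + (k + k) by ring,
    zpow_sub₀ hQ0, zpow_add₀ hQ0 (k ^ 2 + 1), zpow_add₀ hQ0 (k ^ 2) 1, zpow_add₀ hQ0 k k, zpow_one]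
  have hs : (-1 : ℂ) ≠ 0 := by norm_num
  have h2 : (Q ^ 2 : ℂ) ≠ 0 := pow_ne_zero 2 hQ0
  rw [zpow_sub₀ hs, zpow_add₀ hs]
  simp only [zpow_sub₀ h2, zpow_add₀ h2, zpow_natCast, zpow_one]
  have hk : (Q ^ 2) ^ k = (Q ^ k) ^ 2 := by
    rw [← zpow_natCast, ← zpow_natCast, ← zpow_mul, ← zpow_mul, mul_comm]
  rw [hk]
  have hu : Q ^ k ≠ 0 := zpow_ne_zero k hQ0
  generalize Q ^ k = u at *
  generalize Q ^ (k ^ 2) = E at *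
  generalize (-1 : ℂ) ^ k = s at *
  generalize qPoch (Q ^ 2) (Q ^ 2) (2 * n) = P at *
  rw [show (Q ^ 2) ^ (2 * n + 1) = (Q ^ 2) ^ n * (Q ^ 2) ^ n * Q ^ 2 by ring,
    show (Q ^ 2) ^ (2 * n) = (Q ^ 2) ^ n * (Q ^ 2) ^ n by ring]
  generalize (Q ^ 2) ^ n = v at *
  field_simp
  ring

theorem tripleCoeff_zero (Q : ℂ) (k : ℤ) : tripleCoeff Q 0 k = if k = 0 then 1 else 0 := by
  unfold tripleCoeff invQPoch
  split_ifs with h1 h2 h3 h3 h3 h3 <;> first | omega | skip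
  · subst h3; simp [qPoch]
  · simp
  · simp

theorem hasSum_tripleCoeff {Q : ℂ} (hQ0 : Q ≠ 0) (hQ : ‖Q‖ < 1) {w : ℂ} (hw : w ≠ 0) (n : ℕ) :
    HasSum (fun k : ℤ => tripleCoeff Q n k * w ^ k)
      (qPoch (w * Q) (Q ^ 2) n * qPoch (Q / w) (Q ^ 2) n) := by
  induction n with
  | zero =>
    simp only [tripleCoeff_zero, qPoch_zero, mul_one]
    convert hasSum_ite_eq (0 : ℤ) (1 : ℂ) using 2 with k
    split_ifs with h <;> simp [h]
  | succ n ih =>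
    have h1 := (Equiv.subRight (1 : ℤ)).hasSum_iff.2 ih
    have h2 := (Equiv.addRight (1 : ℤ)).hasSum_iff.2 ih
    have h3 := (ih.mul_left (1 + Q ^ 2 * (Q ^ 2) ^ (2 * n))).sub
      (((h1.mul_left w).add (h2.mul_left w⁻¹)).mul_left (Q * (Q ^ 2) ^ n))
    have hval : qPoch (w * Q) (Q ^ 2) (n + 1) * qPoch (Q / w) (Q ^ 2) (n + 1) =
        (1 + Q ^ 2 * (Q ^ 2) ^ (2 * n)) * (qPoch (w * Q) (Q ^ 2) n * qPoch (Q / w) (Q ^ 2) n) -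
          Q * (Q ^ 2) ^ n *
            (w * (qPoch (w * Q) (Q ^ 2) n * qPoch (Q / w) (Q ^ 2) n) +
              w⁻¹ * (qPoch (w * Q) (Q ^ 2) n * qPoch (Q / w) (Q ^ 2) n)) := by
      rw [qPoch_succ, qPoch_succ]
      field_simp
      ring
    rw [hval]
    refine HasSum.congr_fun h3 fun k => ?_
    simp only [Function.comp_apply, Equiv.subRight_apply, Equiv.coe_addRight]
    rw [tripleCoeff_succ hQ0 hQ, zpow_sub_one₀ hw, zpow_add_one₀ hw]
    field_simp

/-- Let n → ∞ in `hasSum_tripleCoeff`. The q-binomial factors are bounded uniformly in n and k, so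
dominated convergence applies, and each tends to 1 / (Q²; Q²)_∞. -/
theorem jacobi_triple_product {Q : ℂ} (hQ0 : Q ≠ 0) (hQ : ‖Q‖ < 1) {w : ℂ} (hw : w ≠ 0) :
    HasSum (fun k : ℤ => (-1) ^ k * Q ^ (k ^ 2) * w ^ k)
      (qPochInf (w * Q) (Q ^ 2) * qPochInf (Q / w) (Q ^ 2) * qPochInf (Q ^ 2) (Q ^ 2)) := by
  have hp := norm_sq_lt_one hQ two_ne_zero
  obtain ⟨C, hC0, hC⟩ := exists_norm_invQPoch_le hp
  obtain ⟨D, hD⟩ := (Metric.isBounded_range_of_tendsto _ (tendsto_qPoch (Q ^ 2) hp)).exists_norm_le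
  have hD0 : 0 ≤ D := (norm_nonneg _).trans (hD _ ⟨0, rfl⟩)
  set M := max ‖w‖ ‖w‖⁻¹
  have hb : Summable fun k : ℤ => ‖Q‖ ^ k.natAbs ^ 2 * M ^ k.natAbs :=
    summable_int_pow_sq_mul_pow (norm_nonneg _) hQ M
  have hnorm : ∀ k : ℤ, ‖(-1 : ℂ) ^ k * Q ^ (k ^ 2) * w ^ k‖ ≤
      ‖Q‖ ^ k.natAbs ^ 2 * M ^ k.natAbs := fun k => by
    rw [norm_mul, norm_mul, norm_zpow, norm_neg, norm_one, one_zpow, one_mul, zpow_sq_eq, norm_pow]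
    exact mul_le_mul_of_nonneg_left (norm_zpow_le (le_max_left _ _) (le_max_right _ _) k)
      (by positivity)
  have hsum : Summable fun k : ℤ => (-1) ^ k * Q ^ (k ^ 2) * w ^ k :=
    hb.of_norm_bounded hnorm
  have hc0 := qPochInf_self_ne_zero hp
  have hinv : Tendsto (invQPoch (Q ^ 2)) atTop (𝓝 (qPochInf (Q ^ 2) (Q ^ 2))⁻¹) := by
    have ht : Tendsto (fun n => (qPoch (Q ^ 2) (Q ^ 2) n)⁻¹) atTop
      (𝓝 (qPochInf (Q ^ 2) (Q ^ 2))⁻¹) := (tendsto_qPoch _ hp).inv₀ hc0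
    have h2 : Tendsto Int.toNat atTop atTop := tendsto_atTop.2 fun b => by
      filter_upwards [eventually_ge_atTop (b : ℤ)] with a ha
      omega
    refine (ht.comp h2).congr' ?_
    filter_upwards [eventually_ge_atTop (0 : ℤ)] with a ha
    simp [invQPoch, ha]
  have hlim : Tendsto (fun n : ℕ => ∑' k : ℤ, tripleCoeff Q n k * w ^ k) atTop
      (𝓝 (∑' k : ℤ, (-1) ^ k * Q ^ (k ^ 2) * w ^ k * (qPochInf (Q ^ 2) (Q ^ 2))⁻¹)) := by
    refine tendsto_tsum_of_dominated_convergence (hb.mul_left (D * (C * C))) ?_ ?_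
    · intro k
      have t1 : Tendsto (fun n : ℕ => (n : ℤ) - k) atTop atTop :=
        tendsto_atTop_add_const_right _ (-k) tendsto_natCast_atTop_atTop
      have t2 : Tendsto (fun n : ℕ => (n : ℤ) + k) atTop atTop :=
        tendsto_atTop_add_const_right _ k tendsto_natCast_atTop_atTop
      have t3 : Tendsto (fun n : ℕ => 2 * n) atTop atTop :=
        tendsto_id.const_mul_atTop' two_pos
      have := ((((tendsto_qPoch (Q ^ 2) hp).comp t3).const_mul ((-1 : ℂ) ^ k * Q ^ (k ^ 2))).mul
        ((hinv.comp t1).mul (hinv.comp t2))).mul_const (w ^ k)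
      convert this using 2
      · simp only [tripleCoeff, Function.comp_apply]
      · field_simp [hc0]
    · refine Eventually.of_forall fun n k => ?_
      have e : tripleCoeff Q n k * w ^ k = ((-1) ^ k * Q ^ (k ^ 2) * w ^ k) *
          (qPoch (Q ^ 2) (Q ^ 2) (2 * n) *
            (invQPoch (Q ^ 2) (n - k) * invQPoch (Q ^ 2) (n + k))) := by
        unfold tripleCoeff; ring
      rw [e, norm_mul, mul_comm, norm_mul, norm_mul]
      gcongr
      · exact hD _ ⟨_, rfl⟩
      · exact hC _
      · exact hC _
      · exact hnorm k
  have hlim2 : Tendsto (fun n : ℕ => ∑' k : ℤ, tripleCoeff Q n k * w ^ k) atTop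
      (𝓝 (qPochInf (w * Q) (Q ^ 2) * qPochInf (Q / w) (Q ^ 2))) := by
    simp only [fun n => (hasSum_tripleCoeff hQ0 hQ hw n).tsum_eq]
    exact (tendsto_qPoch _ hp).mul (tendsto_qPoch _ hp)
  have := tendsto_nhds_unique hlim2 hlim
  rw [this, tsum_mul_right, mul_assoc, inv_mul_cancel₀ hc0, mul_one]
  exact hsum.hasSum

/-! ### Uniqueness for the functional equation -/

/-- A function that is analytic off the origin and satisfies `h (q² z) = -q h z` vanishes. -/
theorem eq_zero_of_quasiperiodic {q : ℂ} (hq0 : q ≠ 0) (hq1 : ‖q‖ < 1) {h : ℂ → ℂ}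
    (hd : ∀ z, z ≠ 0 → DifferentiableAt ℂ h z) (hf : ∀ z, z ≠ 0 → h (q ^ 2 * z) = -q * h z) :
    ∀ z, z ≠ 0 → h z = 0 := by
  -- Since exp(-ω/2) = 1/q, the twist by exp(-s/2) turns the multiplier -q into -1; its price is a
  -- sign -1 along 2πi, harmless for the norm.
  set U : ℂ → ℂ := fun s => h (Complex.exp s) * Complex.exp (-s / 2) with hU
  set ω : ℂ := 2 * Complex.log q with hω
  have hexpω : Complex.exp ω = q ^ 2 := by
    rw [hω, two_mul, Complex.exp_add, Complex.exp_log hq0, sq]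
  have hU1 : ∀ s, U (s + ω) = -U s := fun s => by
    simp only [hU]
    rw [Complex.exp_add, hexpω, mul_comm _ (q ^ 2), hf _ (Complex.exp_ne_zero s),
      show -(s + ω) / 2 = -s / 2 + -Complex.log q by rw [hω]; ring, Complex.exp_add,
      Complex.exp_neg (Complex.log q), Complex.exp_log hq0]
    field_simp
  have hU2 : ∀ s, U (s + 2 * Real.pi * Complex.I) = -U s := fun s => by
    simp only [hU]
    rw [Complex.exp_add, Complex.exp_two_pi_mul_I, mul_one,
      show -(s + 2 * Real.pi * Complex.I) / 2 = -s / 2 + -(Real.pi * Complex.I) by ring,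
      Complex.exp_add, Complex.exp_neg (Real.pi * Complex.I), Complex.exp_pi_mul_I]
    norm_num
  have hUd : Differentiable ℂ U := fun s => by
    have h1 : DifferentiableAt ℂ (fun s => h (Complex.exp s)) s :=
      (hd _ (Complex.exp_ne_zero s)).comp s Complex.differentiableAt_exp
    exact h1.mul (by fun_prop)
  have hP1 : Function.Periodic (fun s => ‖U s‖) ω := fun s => by simp only [hU1, norm_neg]
  have hP2 : Function.Periodic (fun s => ‖U s‖) (2 * Real.pi * Complex.I) := fun s => by
    simp only [hU2, norm_neg]
  have hr : ω.re < 0 := by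
    have : Real.log ‖q‖ < 0 := Real.log_neg (norm_pos_iff.2 hq0) hq1
    have e : ω.re = 2 * Real.log ‖q‖ := by simp [hω, Complex.log_re]
    linarith
  obtain ⟨C, hC⟩ := (isCompact_closedBall (0 : ℂ)
    (|ω.re| + 2 * Real.pi)).exists_bound_of_continuousOn hUd.continuous.continuousOn
  -- Reduce `s` modulo the two periods of ‖U‖: first the real part by ω, then the imaginary part by
  -- 2πi, which leaves the real part alone.
  have hbd : ∀ s, ‖U s‖ ≤ C := fun s => by
    set s1 := s - (⌊s.re / ω.re⌋ : ℤ) * ω with hs1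
    set s2 := s1 - (⌊s1.im / (2 * Real.pi)⌋ : ℤ) * (2 * Real.pi * Complex.I) with hs2
    have e1 : ‖U s1‖ = ‖U s‖ := (hP1.int_mul _).sub_eq s
    have e2 : ‖U s2‖ = ‖U s1‖ := (hP2.int_mul _).sub_eq s1
    rw [← e1, ← e2]
    refine hC _ ?_
    rw [mem_closedBall_zero_iff]
    have hpi := Real.two_pi_pos
    have r1 : s2.re = Int.fract (s.re / ω.re) * ω.re := by
      have : s2.re = s.re - ⌊s.re / ω.re⌋ * ω.re := by simp [hs2, hs1]
      rw [this, ← Int.self_sub_floor, sub_mul, div_mul_cancel₀ _ hr.ne]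
    have r2 : s2.im = Int.fract (s1.im / (2 * Real.pi)) * (2 * Real.pi) := by
      have : s2.im = s1.im - ⌊s1.im / (2 * Real.pi)⌋ * (2 * Real.pi) := by simp [hs2]
      rw [this, ← Int.self_sub_floor, sub_mul, div_mul_cancel₀ _ hpi.ne']
    refine (Complex.norm_le_abs_re_add_abs_im s2).trans (add_le_add ?_ ?_)
    · rw [r1, abs_mul, abs_of_nonneg (Int.fract_nonneg _)]
      exact mul_le_of_le_one_left (abs_nonneg _) (Int.fract_lt_one _).le
    · rw [r2, abs_mul, abs_of_nonneg (Int.fract_nonneg _), abs_of_pos hpi]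
      exact mul_le_of_le_one_left hpi.le (Int.fract_lt_one _).le
  have hconst := fun s t => hUd.apply_eq_apply_of_bounded
    ((isBounded_iff_forall_norm_le).2 ⟨C, by rintro _ ⟨s, rfl⟩; exact hbd s⟩) s t
  have hU0 : ∀ s, U s = 0 := fun s => by
    have h1 := hU1 s
    rw [hconst (s + ω) s] at h1
    exact self_eq_neg.1 h1
  intro z hz
  have := hU0 (Complex.log z)
  simp only [hU, Complex.exp_log hz, mul_eq_zero, Complex.exp_ne_zero, or_false] at this
  exact this

/-! ### Denominators `1 + q ^ m` and `1 - q ^ m` -/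

theorem norm_zpow_ne_one {q : ℂ} (hq1 : ‖q‖ < 1) {m : ℤ} (hm : m ≠ 0) :
    ‖q ^ m‖ ≠ 1 := by
  rw [norm_zpow]
  intro h
  exact hm ((zpow_eq_one_iff_right₀ (norm_nonneg q) hq1.ne).1 h)

theorem one_add_zpow_ne_zero {q : ℂ} (hq1 : ‖q‖ < 1) (m : ℤ) : 1 + q ^ m ≠ 0 := by
  rcases eq_or_ne m 0 with rfl | hm
  · norm_num
  · intro h
    refine norm_zpow_ne_one hq1 hm ?_
    rw [show q ^ m = -1 by linear_combination h]
    simp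

theorem one_sub_zpow_ne_zero {q : ℂ} (hq1 : ‖q‖ < 1) {m : ℤ} (hm : m ≠ 0) :
    1 - q ^ m ≠ 0 := by
  intro h
  refine norm_zpow_ne_one hq1 hm ?_
  rw [show q ^ m = 1 by linear_combination -h]
  simp

theorem norm_inv_one_add_le {w : ℂ} {r : ℝ} (hr : r < 1) (hw : ‖w‖ ≤ r) :
    ‖(1 + w)⁻¹‖ ≤ (1 - r)⁻¹ := by
  rw [norm_inv]
  refine inv_anti₀ (by linarith) ?_
  have := norm_sub_norm_le (1 : ℂ) (-w)
  rw [norm_one, norm_neg, sub_neg_eq_add] at this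
  linarith

theorem norm_inv_one_add_le' {w : ℂ} {r : ℝ} (hr : r < 1) (hw0 : w ≠ 0) (hw : ‖w‖⁻¹ ≤ r) :
    ‖(1 + w)⁻¹‖ ≤ ‖w‖⁻¹ * (1 - r)⁻¹ := by
  have e : (1 + w)⁻¹ = w⁻¹ * (1 + w⁻¹)⁻¹ := by
    rw [← mul_inv, mul_add, mul_one, mul_inv_cancel₀ hw0, add_comm]
  rw [e, norm_mul, norm_inv]
  exact mul_le_mul_of_nonneg_left (norm_inv_one_add_le hr (by rwa [norm_inv])) (by positivity)

/-- For negative `m` the power dominates the 1, which gives decay; the second entry of the minimum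
keeps it for the double series. -/
theorem norm_inv_one_add_zpow_le {q : ℂ} (hq0 : q ≠ 0) (hq1 : ‖q‖ < 1) (m : ℤ) :
    ‖(1 + q ^ m)⁻¹‖ ≤ (1 - ‖q‖)⁻¹ * min 1 (‖q‖ ^ (-m)) := by
  have hpos := norm_pos_iff.2 hq0
  have h1 : (1 : ℝ) ≤ (1 - ‖q‖)⁻¹ := (one_le_inv₀ (by linarith)).2 (by linarith)
  rcases lt_trichotomy m 0 with h | rfl | h
  · have hle : ‖q‖ ^ (-m) ≤ ‖q‖ := by
      simpa using zpow_le_zpow_right_of_le_one₀ hpos hq1.le (show (1 : ℤ) ≤ -m by omega)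
    have := norm_inv_one_add_le' (w := q ^ m) hq1 (zpow_ne_zero _ hq0)
      (by rw [norm_zpow, ← zpow_neg]; exact hle)
    rw [min_eq_right (hle.trans hq1.le), mul_comm]
    rwa [norm_zpow, ← zpow_neg] at this
  · norm_num
    linarith
  · have hle : ‖q‖ ^ m ≤ ‖q‖ := by
      simpa using zpow_le_zpow_right_of_le_one₀ hpos hq1.le (show (1 : ℤ) ≤ m by omega)
    have h2 : (1 : ℝ) ≤ ‖q‖ ^ (-m) := by
      rw [zpow_neg]
      exact (one_le_inv₀ (zpow_pos hpos _)).2 (hle.trans hq1.le)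
    rw [min_eq_left h2, mul_one]
    exact norm_inv_one_add_le hq1 (by rwa [norm_zpow])

/-! ### The theta function θ(z) -/

section
variable {q : ℂ}

theorem hasSum_thetaProd (hq0 : q ≠ 0) (hq1 : ‖q‖ < 1) {z : ℂ} (hz : z ≠ 0) :
    HasSum (fun k : ℤ => (-1) ^ k * q ^ (2 * k ^ 2) * z ^ (2 * k)) (thetaProd z q) := by
  have h := jacobi_triple_product (pow_ne_zero 2 hq0) (norm_sq_lt_one hq1 two_ne_zero)
    (pow_ne_zero 2 hz)
  rw [← pow_mul] at h
  refine h.congr_fun fun k => ?_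
  rw [zpow_mul, zpow_mul]
  rfl

/-- Completing the square: the shift k ↦ k + 1 in the theta series absorbs the factor q^{4k}. -/
theorem thetaProd_sq_mul (hq0 : q ≠ 0) (hq1 : ‖q‖ < 1) {z : ℂ} (hz : z ≠ 0) :
    thetaProd (q ^ 2 * z) q = -(q ^ 2 * z ^ 2)⁻¹ * thetaProd z q := by
  have hz' : q ^ 2 * z ≠ 0 := mul_ne_zero (pow_ne_zero 2 hq0) hz
  have h1 := hasSum_thetaProd hq0 hq1 hz'
  have h2 := ((Equiv.addRight (1 : ℤ)).hasSum_iff.2 (hasSum_thetaProd hq0 hq1 hz)).mul_left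
    (-(q ^ 2 * z ^ 2)⁻¹)
  refine h1.unique (h2.congr_fun fun k => ?_)
  simp only [Function.comp_apply, Equiv.coe_addRight]
  rw [show 2 * (k + 1) ^ 2 = 2 * k ^ 2 + 2 * (2 * k) + 2 by ring, zpow_add₀ hq0, zpow_add₀ hq0,
    mul_zpow, show 2 * (k + 1) = 2 * k + 2 by ring, zpow_add₀ hz, zpow_add_one₀ (by norm_num),
    ← zpow_natCast, ← zpow_mul]
  push_cast
  field_simp
-- Splitting 1 - x² = (1 - x)(1 + x) isolates (zq, q/z; q²)_∞, which cancels the denominators of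
-- `F8`.
theorem thetaProd_eq (hq1 : ‖q‖ < 1) (z : ℂ) :
    thetaProd z q = qPochInf (z * q) (q ^ 2) * qPochInf (-(z * q)) (q ^ 2) *
      (qPochInf (q / z) (q ^ 2) * qPochInf (-(q / z)) (q ^ 2)) * qPochInf (q ^ 4) (q ^ 4) := by
  have hp := norm_sq_lt_one hq1 two_ne_zero
  rw [← qPochInf_sq _ hp, ← qPochInf_sq _ hp, thetaProd]
  ring_nf

/-! ### The series `F8`: convergence and functional equation -/

/-- The coefficient `(-1)^n (q; q²)_n q^{(n+1)²}` of the series `F8`. -/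
def F8Coeff (q : ℂ) (n : ℕ) : ℂ := (-1) ^ n * qPoch q (q ^ 2) n * q ^ ((n + 1) ^ 2)

theorem exists_norm_qPoch_le {a p : ℂ} (hp : ‖p‖ < 1) : ∃ C, 0 ≤ C ∧ ∀ n, ‖qPoch a p n‖ ≤ C := by
  obtain ⟨D, hD⟩ := (Metric.isBounded_range_of_tendsto _ (tendsto_qPoch a hp)).exists_norm_le
  exact ⟨D, (norm_nonneg _).trans (hD _ ⟨0, rfl⟩), fun n => hD _ ⟨n, rfl⟩⟩

theorem exists_norm_inv_qPoch_le {a p : ℂ} (hp : ‖p‖ < 1) (ha : ∀ k : ℕ, a * p ^ k ≠ 1) :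
    ∃ C, 0 ≤ C ∧ ∀ n, ‖(qPoch a p n)⁻¹‖ ≤ C := by
  obtain ⟨D, hD⟩ := (Metric.isBounded_range_of_tendsto _
    ((tendsto_qPoch a hp).inv₀ (qPochInf_ne_zero hp ha))).exists_norm_le
  exact ⟨D, (norm_nonneg _).trans (hD _ ⟨0, rfl⟩), fun n => hD _ ⟨n, rfl⟩⟩

theorem summable_norm_pow_sq (hq1 : ‖q‖ < 1) : Summable fun n : ℕ => ‖q‖ ^ n ^ 2 := by
  simpa using summable_nat_pow_sq_mul_pow (norm_nonneg q) hq1 1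

theorem exists_norm_F8Coeff_le (hq1 : ‖q‖ < 1) :
    ∃ C, 0 ≤ C ∧ ∀ n, ‖F8Coeff q n‖ ≤ C * ‖q‖ ^ (n + 1) ^ 2 := by
  obtain ⟨C, hC0, hC⟩ := exists_norm_qPoch_le (a := q) (norm_sq_lt_one hq1 two_ne_zero)
  refine ⟨C, hC0, fun n => ?_⟩
  rw [F8Coeff, norm_mul, norm_mul, norm_pow, norm_neg, norm_one, one_pow, one_mul, norm_pow]
  gcongr
  exact hC n

theorem mul_pow_ne_one {z : ℂ} (hz : ∀ m : ℤ, z ≠ q ^ (2 * m + 1)) (k : ℕ) :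
    z * q * (q ^ 2) ^ k ≠ 1 := by
  intro h
  refine hz (-(k + 1 : ℤ)) ?_
  have e : 2 * -((k : ℤ) + 1) + 1 = -((2 * k + 1 : ℕ) : ℤ) := by push_cast; ring
  rw [e, zpow_neg, zpow_natCast]
  exact eq_inv_of_mul_eq_one_left (by rw [← h]; ring)

theorem div_mul_pow_ne_one {z : ℂ} (hz0 : z ≠ 0) (hz : ∀ m : ℤ, z ≠ q ^ (2 * m + 1))
    (k : ℕ) : q / z * (q ^ 2) ^ k ≠ 1 := by
  intro h
  refine hz k ?_
  have e : 2 * (k : ℤ) + 1 = ((2 * k + 1 : ℕ) : ℤ) := by push_cast; ring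
  rw [e, zpow_natCast]
  field_simp at h
  rw [← h]
  ring

theorem F8Term_eq (z : ℂ) (n : ℕ) :
    F8Term z q n = F8Coeff q n *
      ((qPoch (z * q) (q ^ 2) (n + 1))⁻¹ * (qPoch (q / z) (q ^ 2) (n + 1))⁻¹) := by
  rw [F8Term, F8Coeff, ← mul_inv, div_eq_mul_inv]

theorem summable_F8Term (hq0 : q ≠ 0) (hq1 : ‖q‖ < 1) {z : ℂ} (hz0 : z ≠ 0)
    (hz : ∀ m : ℤ, z ≠ q ^ (2 * m + 1)) : Summable (F8Term z q) := by
  have hp := norm_sq_lt_one hq1 two_ne_zero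
  obtain ⟨C, hC0, hC⟩ := exists_norm_F8Coeff_le hq1
  obtain ⟨C1, hC10, hC1⟩ := exists_norm_inv_qPoch_le hp (mul_pow_ne_one hz)
  obtain ⟨C2, hC20, hC2⟩ := exists_norm_inv_qPoch_le hp (div_mul_pow_ne_one hz0 hz)
  have hs := (((summable_nat_add_iff 1).2 (summable_norm_pow_sq hq1)).mul_left C).mul_right (C1 * C2)
  refine hs.of_norm_bounded fun n => ?_
  rw [F8Term_eq, norm_mul, norm_mul]
  gcongr
  · exact hC n
  · exact hC1 _
  · exact hC2 _

/-- The certificate for the telescoping proof of the functional equation of `F8`. -/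
def F8Cert (z q : ℂ) (n : ℕ) : ℂ :=
  (-1) ^ n * qPoch q (q ^ 2) n * q ^ n ^ 2 * (q ^ 2 * z * (1 - q ^ 2 * z ^ 2) * (q ^ 2) ^ n) *
    ((qPoch (z * q) (q ^ 2) (n + 1))⁻¹ * (qPoch (q / z) (q ^ 2) n)⁻¹)

/-- Replacing z by q²z only shifts the two denominators by one factor each. After the common
Pochhammer factors are removed, a rational identity in q, z and (q²)^n remains. -/
theorem F8Term_sq_mul (hq0 : q ≠ 0) {z : ℂ} (hz0 : z ≠ 0)
    (hz : ∀ m : ℤ, z ≠ q ^ (2 * m + 1)) (n : ℕ) :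
    (1 - q ^ 2 * z) * F8Term (q ^ 2 * z) q n - q ^ 3 * z ^ 2 * (1 - z) * F8Term z q n =
      F8Cert z q (n + 1) - F8Cert z q n := by
  have h1 := mul_pow_ne_one hz
  have h2 := div_mul_pow_ne_one hz0 hz
  have e1 : (1 - z * q) * qPoch (q ^ 2 * z * q) (q ^ 2) (n + 1) = qPoch (z * q) (q ^ 2) (n + 2) := by
    rw [qPoch_succ' _ _ (n + 1)]; congr 2; ring
  have e2 : qPoch (q / (q ^ 2 * z)) (q ^ 2) (n + 1) =
      (1 - q / (q ^ 2 * z)) * qPoch (q / z) (q ^ 2) n := by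
    rw [qPoch_succ']; congr 2; field_simp
  have n1 : 1 - z * q ≠ 0 := fun h => h1 0 (by linear_combination -h)
  have n2 : qPoch (z * q) (q ^ 2) (n + 1) ≠ 0 := qPoch_ne_zero fun k _ => h1 k
  have n3 : qPoch (q / z) (q ^ 2) n ≠ 0 := qPoch_ne_zero fun k _ => h2 k
  have n4 : 1 - z * q * (q ^ 2) ^ (n + 1) ≠ 0 := fun h => h1 (n + 1) (by linear_combination -h)
  have n5 : 1 - q / z * (q ^ 2) ^ n ≠ 0 := fun h => h2 n (by linear_combination -h)
  have e3 : qPoch (q ^ 2 * z * q) (q ^ 2) (n + 1) =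
      qPoch (z * q) (q ^ 2) (n + 1) * (1 - z * q * (q ^ 2) ^ (n + 1)) / (1 - z * q) := by
    rw [eq_div_iff n1, mul_comm, e1, qPoch_succ]
  simp only [F8Term, F8Cert]
  rw [e2, e3, qPoch_succ (z * q) _ (n + 1), qPoch_succ (q / z) _ n, qPoch_succ q _ n]
  rw [show (q : ℂ) ^ (n + 1) ^ 2 = q ^ n ^ 2 * (q ^ 2) ^ n * q by ring,
    show (q ^ 2) ^ (n + 1) = (q ^ 2) ^ n * q ^ 2 by ring] at *
  have e4 : 1 - q / (q ^ 2 * z) = -(1 - z * q) / (z * q) := by field_simp; ring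
  have e5 : 1 - q / z * (q ^ 2) ^ n = (z - q * (q ^ 2) ^ n) / z := by field_simp
  have n6 : z - q * (q ^ 2) ^ n ≠ 0 := fun h => n5 (by rw [e5, h, zero_div])
  rw [e4, e5]
  generalize qPoch (z * q) (q ^ 2) (n + 1) = A at *
  generalize qPoch (q / z) (q ^ 2) n = B at *
  generalize qPoch q (q ^ 2) n = D at *
  generalize (q ^ 2) ^ n = v at *
  generalize q ^ n ^ 2 = E at *
  rw [pow_succ (-1 : ℂ) n]
  generalize (-1 : ℂ) ^ n = s at *
  generalize ha : 1 - z * q = a at *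
  generalize hb : 1 - z * q * (v * q ^ 2) = b at *
  generalize hd : z - q * v = d at *
  field_simp
  rw [← hb, ← hd]
  ring

theorem tendsto_F8Cert (hq0 : q ≠ 0) (hq1 : ‖q‖ < 1) {z : ℂ} (hz0 : z ≠ 0)
    (hz : ∀ m : ℤ, z ≠ q ^ (2 * m + 1)) : Tendsto (F8Cert z q) atTop (𝓝 0) := by
  have hp := norm_sq_lt_one hq1 two_ne_zero
  obtain ⟨C, hC0, hC⟩ := exists_norm_qPoch_le (a := q) hp
  obtain ⟨C1, hC10, hC1⟩ := exists_norm_inv_qPoch_le hp (mul_pow_ne_one hz)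
  obtain ⟨C2, hC20, hC2⟩ := exists_norm_inv_qPoch_le hp (div_mul_pow_ne_one hz0 hz)
  have hs := (summable_norm_pow_sq hq1).tendsto_atTop_zero.mul_const
    (C * (‖q ^ 2 * z * (1 - q ^ 2 * z ^ 2)‖ * 1) * (C1 * C2))
  rw [zero_mul] at hs
  refine squeeze_zero_norm (fun n => ?_) hs
  have e : ‖F8Cert z q n‖ = ‖q‖ ^ n ^ 2 * (‖qPoch q (q ^ 2) n‖ *
      (‖q ^ 2 * z * (1 - q ^ 2 * z ^ 2)‖ * ‖q ^ 2‖ ^ n) *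
      (‖(qPoch (z * q) (q ^ 2) (n + 1))⁻¹‖ * ‖(qPoch (q / z) (q ^ 2) n)⁻¹‖)) := by
    simp only [F8Cert, norm_mul, norm_pow, norm_neg, norm_one, one_pow, one_mul]
    ring
  rw [e]
  gcongr
  · exact hC n
  · exact pow_le_one₀ (norm_nonneg _) hp.le
  · exact hC1 _
  · exact hC2 _

theorem sq_mul_ne_odd_pow (hq0 : q ≠ 0) {z : ℂ} (hz : ∀ m : ℤ, z ≠ q ^ (2 * m + 1)) (m : ℤ) :
    q ^ 2 * z ≠ q ^ (2 * m + 1) := by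
  intro h
  refine hz (m - 1) (mul_left_cancel₀ (pow_ne_zero 2 hq0) ?_)
  rw [h, ← zpow_natCast, ← zpow_add₀ hq0]
  congr 1
  push_cast
  ring

/-- The certificate tends to 0, so the telescoping sum is `-F8Cert z q 0`, that is -q²z(1 + qz). -/
theorem F8_sq_mul (hq0 : q ≠ 0) (hq1 : ‖q‖ < 1) {z : ℂ} (hz0 : z ≠ 0)
    (hz : ∀ m : ℤ, z ≠ q ^ (2 * m + 1)) :
    (1 - q ^ 2 * z) * F8 (q ^ 2 * z) q =
      q ^ 3 * z ^ 2 * ((1 - z) * F8 z q - 1) - q ^ 2 * z := by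
  have s1 := (summable_F8Term hq0 hq1 (mul_ne_zero (pow_ne_zero 2 hq0) hz0)
    (sq_mul_ne_odd_pow hq0 hz)).hasSum.mul_left (1 - q ^ 2 * z)
  have s2 := (summable_F8Term hq0 hq1 hz0 hz).hasSum.mul_left (q ^ 3 * z ^ 2 * (1 - z))
  have s3 := (s1.sub s2).tendsto_sum_nat
  simp only [F8Term_sq_mul hq0 hz0 hz, Finset.sum_range_sub] at s3
  have s4 := (tendsto_F8Cert hq0 hq1 hz0 hz).sub_const (F8Cert z q 0)
  have h := tendsto_nhds_unique s3 s4
  have h1 := mul_pow_ne_one hz 0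
  have n1 : 1 - z * q ≠ 0 := fun h => h1 (by linear_combination -h)
  have h0 : F8Cert z q 0 = q ^ 2 * z * (1 + q * z) := by
    have e : F8Cert z q 0 = q ^ 2 * z * (1 - q ^ 2 * z ^ 2) * (1 - z * q)⁻¹ := by
      simp [F8Cert, qPoch_succ, qPoch_zero]
    rw [e, mul_inv_eq_iff_eq_mul₀ n1]
    ring
  rw [h0] at h
  simp only [F8]
  linear_combination h

/-! ### The Appell series and its functional equation -/

/-- The terms of the bilateral series, multiplied by `1 - z`. -/
def appellTerm (q : ℂ) (k : ℤ) (z : ℂ) : ℂ :=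
  (-1) ^ (k - 1) * q ^ (2 * k ^ 2) / (1 + q ^ (4 * k - 1)) * (z ^ (1 - 2 * k) - z ^ (2 * k))

theorem norm_zpow_two_mul_sq (q : ℂ) (k : ℤ) : ‖q ^ (2 * k ^ 2)‖ = (‖q‖ ^ 2) ^ k.natAbs ^ 2 := by
  rw [zpow_mul, zpow_sq_eq, norm_pow, norm_zpow]
  rfl

/-- The bound depends on `z` only through `M`, so it is uniform on annuli and permits termwise
differentiation. -/
theorem norm_appellTerm_le (hq0 : q ≠ 0) (hq1 : ‖q‖ < 1) {M : ℝ} {z : ℂ} (hz0 : z ≠ 0)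
    (h1 : ‖z‖ ≤ M) (h2 : ‖z‖⁻¹ ≤ M) (k : ℤ) :
    ‖appellTerm q k z‖ ≤
      (1 - ‖q‖)⁻¹ * (M + 1) * ((‖q‖ ^ 2) ^ k.natAbs ^ 2 * (M ^ 2) ^ k.natAbs) := by
  have hM : 0 ≤ M := (norm_nonneg z).trans h1
  have b1 : ‖z ^ (2 * k)‖ ≤ (M ^ 2) ^ k.natAbs := by
    rw [zpow_mul]
    refine norm_zpow_le ?_ ?_ k
    · simpa using pow_le_pow_left₀ (norm_nonneg z) h1 2
    · simpa using pow_le_pow_left₀ (by positivity) h2 2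
  have b2 : ‖z ^ (1 - 2 * k)‖ ≤ M * (M ^ 2) ^ k.natAbs := by
    rw [show 1 - 2 * k = 1 + 2 * -k by ring, zpow_add₀ hz0, zpow_one, norm_mul, zpow_mul]
    refine mul_le_mul h1 ?_ (norm_nonneg _) hM
    rw [← Int.natAbs_neg]
    refine norm_zpow_le ?_ ?_ _
    · simpa using pow_le_pow_left₀ (norm_nonneg z) h1 2
    · simpa using pow_le_pow_left₀ (by positivity) h2 2
  have b3 : ‖(1 + q ^ (4 * k - 1))⁻¹‖ ≤ (1 - ‖q‖)⁻¹ :=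
    (norm_inv_one_add_zpow_le hq0 hq1 _).trans
      (mul_le_of_le_one_right (inv_nonneg.2 (by linarith)) (min_le_left _ _))
  have b4 : ‖z ^ (1 - 2 * k) - z ^ (2 * k)‖ ≤ (M + 1) * (M ^ 2) ^ k.natAbs :=
    (norm_sub_le _ _).trans (by linarith)
  have hc : (0 : ℝ) ≤ (1 - ‖q‖)⁻¹ := inv_nonneg.2 (by linarith)
  rw [appellTerm, div_eq_mul_inv, norm_mul, norm_mul, norm_mul, norm_zpow, norm_neg, norm_one,
    one_zpow, one_mul, norm_zpow_two_mul_sq]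
  calc (‖q‖ ^ 2) ^ k.natAbs ^ 2 * ‖(1 + q ^ (4 * k - 1))⁻¹‖ * ‖z ^ (1 - 2 * k) - z ^ (2 * k)‖
      ≤ (‖q‖ ^ 2) ^ k.natAbs ^ 2 * (1 - ‖q‖)⁻¹ * ((M + 1) * (M ^ 2) ^ k.natAbs) := by gcongr
    _ = _ := by ring

theorem summable_appellBound (hq1 : ‖q‖ < 1) (M : ℝ) : Summable fun k : ℤ =>
    (1 - ‖q‖)⁻¹ * (M + 1) * ((‖q‖ ^ 2) ^ k.natAbs ^ 2 * (M ^ 2) ^ k.natAbs) :=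
  (summable_int_pow_sq_mul_pow (by positivity)
    (pow_lt_one₀ (norm_nonneg q) hq1 two_ne_zero) _).mul_left _

theorem summable_appellTerm (hq0 : q ≠ 0) (hq1 : ‖q‖ < 1) {z : ℂ} (hz0 : z ≠ 0) :
    Summable fun k => appellTerm q k z :=
  (summable_appellBound hq1 (max ‖z‖ ‖z‖⁻¹)).of_norm_bounded fun k =>
    norm_appellTerm_le hq0 hq1 hz0 (le_max_left _ _) (le_max_right _ _) k

/-- The annulus `1 / M < |z| < M`. -/
def annulus (M : ℝ) : Set ℂ := {z | z ≠ 0 ∧ ‖z‖ < M ∧ ‖z⁻¹‖ < M}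

theorem isOpen_annulus (M : ℝ) : IsOpen (annulus M) := by
  have : annulus M = ({0}ᶜ ∩ (fun z : ℂ => ‖z⁻¹‖) ⁻¹' Set.Iio M) ∩ Metric.ball 0 M := by
    ext z
    simp [annulus, and_assoc, and_comm (a := ‖z‖ < M)]
  rw [this]
  refine (ContinuousOn.isOpen_inter_preimage ?_ isOpen_compl_singleton isOpen_Iio).inter
    Metric.isOpen_ball
  exact (continuousOn_inv₀).norm

theorem mem_annulus {z : ℂ} (hz : z ≠ 0) : z ∈ annulus (max ‖z‖ ‖z⁻¹‖ + 1) :=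
  ⟨hz, (le_max_left _ _).trans_lt (lt_add_one _), (le_max_right _ _).trans_lt (lt_add_one _)⟩

theorem differentiableOn_appellTerm (k : ℤ) (M : ℝ) :
    DifferentiableOn ℂ (appellTerm q k) (annulus M) := by
  refine DifferentiableOn.const_mul (DifferentiableOn.sub ?_ ?_) _ <;>
  exact differentiableOn_zpow _ _ (Or.inl fun h => h.1 rfl)

/-- The bilateral series, multiplied by `1 - z`. -/
def appellSum (q z : ℂ) : ℂ := ∑' k, appellTerm q k z

theorem differentiableAt_appellSum (hq0 : q ≠ 0) (hq1 : ‖q‖ < 1) {z : ℂ} (hz0 : z ≠ 0) :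
    DifferentiableAt ℂ (appellSum q) z := by
  refine (Complex.differentiableOn_tsum_of_summable_norm (summable_appellBound hq1 (max ‖z‖ ‖z⁻¹‖ + 1))
    (fun k => differentiableOn_appellTerm k _) (isOpen_annulus _) (fun k w hw => ?_)).differentiableAt
    ((isOpen_annulus _).mem_nhds (mem_annulus hz0))
  exact norm_appellTerm_le hq0 hq1 hw.1 hw.2.1.le (by simpa using hw.2.2.le) k

/-- In the term at q²z plus q times the term at z, both powers of z acquire a multiple of 1 +
q^{4k-1}. The denominator cancels and two theta series are left, one of them with k replaced by -k.
-/
theorem appellSum_sq_mul (hq0 : q ≠ 0) (hq1 : ‖q‖ < 1) {z : ℂ} (hz0 : z ≠ 0) :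
    appellSum q (q ^ 2 * z) = (q + z⁻¹) * thetaProd z q - q * appellSum q z := by
  have hz' : q ^ 2 * z ≠ 0 := mul_ne_zero (pow_ne_zero 2 hq0) hz0
  have h1 := (summable_appellTerm hq0 hq1 hz').hasSum
  have h2 := ((summable_appellTerm hq0 hq1 hz0).hasSum).mul_left q
  have h3 := (hasSum_thetaProd hq0 hq1 hz0).mul_left q
  have h4 := ((Equiv.neg ℤ).hasSum_iff.2 (hasSum_thetaProd hq0 hq1 hz')).mul_left (q ^ 2 * z)
  rw [thetaProd_sq_mul hq0 hq1 hz0] at h4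
  have h5 := (h3.sub h4).sub h2
  have h6 := h1.unique (h5.congr_fun fun k => ?_)
  · change appellSum q (q ^ 2 * z) = _ at h6
    rw [h6]
    change _ = (q + z⁻¹) * thetaProd z q - q * ∑' k, appellTerm q k z
    field_simp
    ring
  · have hd := one_add_zpow_ne_zero hq1 (4 * k - 1)
    simp only [appellTerm, Function.comp_apply, Equiv.neg_apply]
    rw [zpow_sub_one₀ (by norm_num : (-1 : ℂ) ≠ 0)]
    rw [zpow_sub_one₀ hq0] at hd ⊢
    rw [neg_sq, show 2 * -k = -(2 * k) by ring, zpow_sub₀ hz', zpow_sub₀ hz0, zpow_one, zpow_one,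
      zpow_neg (q ^ 2 * z), mul_zpow, show (q ^ 2) ^ (2 * k) = q ^ (4 * k) by
        rw [← zpow_natCast, ← zpow_mul]; congr 1; push_cast; ring]
    have hs : ((-1 : ℂ) ^ (-k)) = (-1) ^ k := by
      rw [zpow_neg, ← inv_zpow]; norm_num
    rw [hs]
    have hA : q ^ (4 * k) ≠ 0 := zpow_ne_zero _ hq0
    have hB : z ^ (2 * k) ≠ 0 := zpow_ne_zero _ hz0
    generalize q ^ (4 * k) = A at *
    generalize z ^ (2 * k) = B at *
    generalize q ^ (2 * k ^ 2) = E at *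
    generalize (-1 : ℂ) ^ k = s at *
    have hd' : q + A ≠ 0 := fun h => hd (by field_simp; simpa using h)
    rw [show 1 + A * q⁻¹ = (q + A) / q by field_simp]
    generalize hc : q + A = c at *
    field_simp
    rw [← hc]
    ring

/-! ### Removing the poles, and identity (i) -/

/-- The analytic continuation of `thetaProd z q * F8 z q` to the punctured plane. -/
def thetaF8 (q z : ℂ) : ℂ :=
  qPochInf (q ^ 4) (q ^ 4) * (qPochInf (-(z * q)) (q ^ 2) * qPochInf (-(q / z)) (q ^ 2)) *
    ∑' n : ℕ, F8Coeff q n * (qPochInf (z * q * (q ^ 2) ^ (n + 1)) (q ^ 2) *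
      qPochInf (q / z * (q ^ 2) ^ (n + 1)) (q ^ 2))

theorem thetaF8_eq (hq1 : ‖q‖ < 1) {z : ℂ} (hz0 : z ≠ 0) (hz : ∀ m : ℤ, z ≠ q ^ (2 * m + 1)) :
    thetaF8 q z = thetaProd z q * F8 z q := by
  have hp := norm_sq_lt_one hq1 two_ne_zero
  have h : F8 z q * (qPochInf (z * q) (q ^ 2) * qPochInf (q / z) (q ^ 2)) =
      ∑' n : ℕ, F8Coeff q n * (qPochInf (z * q * (q ^ 2) ^ (n + 1)) (q ^ 2) *
        qPochInf (q / z * (q ^ 2) ^ (n + 1)) (q ^ 2)) := by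
    rw [F8, ← tsum_mul_right]
    refine tsum_congr fun n => ?_
    have n1 : qPoch (z * q) (q ^ 2) (n + 1) ≠ 0 := qPoch_ne_zero fun k _ => mul_pow_ne_one hz k
    have n2 : qPoch (q / z) (q ^ 2) (n + 1) ≠ 0 :=
      qPoch_ne_zero fun k _ => div_mul_pow_ne_one hz0 hz k
    rw [F8Term_eq, qPochInf_eq_mul (z * q) hp (n + 1), qPochInf_eq_mul (q / z) hp (n + 1)]
    field_simp
  rw [thetaF8, ← h, thetaProd_eq hq1]
  ring

theorem differentiableAt_thetaF8 (hq1 : ‖q‖ < 1) {z : ℂ} (hz0 : z ≠ 0) :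
    DifferentiableAt ℂ (thetaF8 q) z := by
  have hp := norm_sq_lt_one hq1 two_ne_zero
  have hP := differentiable_qPochInf hp
  have hcomp : ∀ {g : ℂ → ℂ} {w : ℂ}, DifferentiableAt ℂ g w →
      DifferentiableAt ℂ (fun x => qPochInf (g x) (q ^ 2)) w := fun {g w} hg =>
    (hP (g w)).comp w hg
  have hdiv : ∀ {w : ℂ}, w ≠ 0 → DifferentiableAt ℂ (fun x : ℂ => q / x) w := fun hw =>
    (differentiableAt_const q).div differentiableAt_id hw
  refine DifferentiableAt.mul (DifferentiableAt.const_mul (DifferentiableAt.mul (hcomp (by fun_prop))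
    (hcomp (hdiv hz0).neg)) _) ?_
  set M := max ‖z‖ ‖z⁻¹‖ + 1
  obtain ⟨C, hC0, hC⟩ := exists_norm_qPochInf_le hp M
  obtain ⟨D, hD0, hD⟩ := exists_norm_F8Coeff_le hq1
  have hs := (((summable_nat_add_iff 1).2 (summable_norm_pow_sq hq1)).mul_left D).mul_right (C * C)
  refine (Complex.differentiableOn_tsum_of_summable_norm hs (fun n => ?_) (isOpen_annulus M)
    (fun n w hw => ?_)).differentiableAt ((isOpen_annulus _).mem_nhds (mem_annulus hz0))
  · intro w hw
    refine DifferentiableAt.differentiableWithinAt (DifferentiableAt.const_mul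
      (DifferentiableAt.mul (hcomp (by fun_prop)) (hcomp ((hdiv hw.1).mul_const _))) _)
  · have hpow : ‖q * (q ^ 2) ^ (n + 1)‖ ≤ 1 := by
      rw [norm_mul, norm_pow]
      exact mul_le_one₀ hq1.le (by positivity) (pow_le_one₀ (norm_nonneg _) hp.le)
    rw [norm_mul, norm_mul]
    gcongr
    · exact hD n
    · refine hC _ ?_
      rw [mul_assoc, norm_mul]
      exact (mul_le_of_le_one_right (norm_nonneg _) hpow).trans hw.2.1.le
    · refine hC _ ?_
      rw [div_eq_mul_inv, mul_right_comm, norm_mul]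
      exact (mul_le_of_le_one_left (norm_nonneg _) hpow).trans hw.2.2.le

/-- The difference of the two sides is analytic off the origin, and the inhomogeneous terms of the
two functional equations cancel, which leaves the multiplier -q. -/
theorem one_sub_mul_thetaF8 (hq0 : q ≠ 0) (hq1 : ‖q‖ < 1) {z : ℂ} (hz0 : z ≠ 0) :
    (1 - z) * thetaF8 q z = appellSum q z := by
  have hd : ∀ z, z ≠ 0 → DifferentiableAt ℂ (fun z => (1 - z) * thetaF8 q z - appellSum q z) z :=
    fun z hz => (DifferentiableAt.mul (by fun_prop) (differentiableAt_thetaF8 hq1 hz)).sub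
      (differentiableAt_appellSum hq0 hq1 hz)
  refine sub_eq_zero.1 (eq_zero_of_quasiperiodic hq0 hq1 hd (fun z hz => ?_) z hz0)
  -- The equation of `F8` is available only off the odd powers of q. These are countable, so their
  -- complement is dense and continuity gives the remaining points.
  have hgen : ∀ z ∈ (Set.range fun m : ℤ => q ^ (2 * m + 1))ᶜ, z ≠ 0 →
      ((1 - q ^ 2 * z) * thetaF8 q (q ^ 2 * z) - appellSum q (q ^ 2 * z)) +
        q * ((1 - z) * thetaF8 q z - appellSum q z) = 0 := fun z hzm hz0 => by
    have hz : ∀ m : ℤ, z ≠ q ^ (2 * m + 1) := fun m h => hzm ⟨m, h.symm⟩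
    rw [thetaF8_eq hq1 hz0 hz, thetaF8_eq hq1 (mul_ne_zero (pow_ne_zero 2 hq0) hz0)
      (sq_mul_ne_odd_pow hq0 hz), appellSum_sq_mul hq0 hq1 hz0, thetaProd_sq_mul hq0 hq1 hz0]
    have := F8_sq_mul hq0 hq1 hz0 hz
    have e : (1 - q ^ 2 * z) * (-(q ^ 2 * z ^ 2)⁻¹ * thetaProd z q * F8 (q ^ 2 * z) q) =
      -(q ^ 2 * z ^ 2)⁻¹ * thetaProd z q * ((1 - q ^ 2 * z) * F8 (q ^ 2 * z) q) := by ring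
    rw [e, this]
    field_simp
    ring
  have hcd : Dense ((Set.range fun m : ℤ => q ^ (2 * m + 1))ᶜ) :=
    (Set.countable_range _).dense_compl ℝ
  have hz' : q ^ 2 * z ≠ 0 := mul_ne_zero (pow_ne_zero 2 hq0) hz
  have hcont : ContinuousAt (fun z => ((1 - q ^ 2 * z) * thetaF8 q (q ^ 2 * z) -
      appellSum q (q ^ 2 * z)) + q * ((1 - z) * thetaF8 q z - appellSum q z)) z := by
    have h1 : ContinuousAt (fun z => (1 - q ^ 2 * z) * thetaF8 q (q ^ 2 * z) -
        appellSum q (q ^ 2 * z)) z :=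
      ContinuousAt.comp (f := fun z => q ^ 2 * z) (g := fun z => (1 - z) * thetaF8 q z - appellSum q z)
        (hd _ hz').continuousAt (by fun_prop)
    exact h1.add (continuousAt_const.mul (hd _ hz).continuousAt)
  have hne := mem_closure_iff_nhdsWithin_neBot.1 (hcd z)
  have hev : ∀ᶠ w in 𝓝[(Set.range fun m : ℤ => q ^ (2 * m + 1))ᶜ] z,
      ((1 - q ^ 2 * w) * thetaF8 q (q ^ 2 * w) - appellSum q (q ^ 2 * w)) +
        q * ((1 - w) * thetaF8 q w - appellSum q w) = 0 := by
    filter_upwards [self_mem_nhdsWithin, nhdsWithin_le_nhds (isOpen_compl_singleton.mem_nhds hz)]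
      with w hw hw0 using hgen w hw hw0
  have h0 := tendsto_nhds_unique (hcont.tendsto.mono_left nhdsWithin_le_nhds)
    ((tendsto_const_nhds (x := (0 : ℂ))).congr' (hev.mono fun w hw => hw.symm))
  linear_combination h0

theorem hasSum_thetaProd_mul_F8 (hq0 : q ≠ 0) (hq1 : ‖q‖ < 1) {z : ℂ} (hz0 : z ≠ 0) (hz1 : z ≠ 1)
    (hz : ∀ m : ℤ, z ≠ q ^ (2 * m + 1)) :
    HasSum
      (fun k : ℤ => (-1 : ℂ) ^ (k - 1) * q ^ (2 * k ^ 2) / (1 + q ^ (4 * k - 1)) *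
        ((z ^ (1 - 2 * k) - z ^ (2 * k)) / (1 - z)))
      (thetaProd z q * F8 z q) := by
  have h := (summable_appellTerm hq0 hq1 hz0).hasSum.mul_right (1 - z)⁻¹
  have hne : 1 - z ≠ 0 := sub_ne_zero.2 hz1.symm
  have e : (∑' k, appellTerm q k z) * (1 - z)⁻¹ = thetaProd z q * F8 z q := by
    rw [← thetaF8_eq hq1 hz0 hz, mul_inv_eq_iff_eq_mul₀ hne, mul_comm,
      one_sub_mul_thetaF8 hq0 hq1 hz0]
    rfl
  rw [e] at h
  refine h.congr_fun fun k => ?_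
  rw [appellTerm, div_eq_mul_inv _ (1 - z), mul_assoc]

end

/-! ### Reduction of forms of discriminant 1 - 8n -/

namespace BinForm

theorem eval_one_zero (f : BinForm) : f.eval 1 0 = f.a := by simp [eval]

theorem eval_zero_one (f : BinForm) : f.eval 0 1 = f.c := by simp [eval]

theorem eval_one_one (f : BinForm) : f.eval 1 1 = f.a + f.b + f.c := by simp [eval]

/-- The form `f (p x + s y, r x + t y)`. -/
def subst (f : BinForm) (p s r t : ℤ) : BinForm :=
  ⟨f.eval p r, 2 * f.a * p * s + f.b * (p * t + s * r) + 2 * f.c * r * t, f.eval s t⟩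

theorem eval_subst (f : BinForm) (p s r t x y : ℤ) :
    (f.subst p s r t).eval x y = f.eval (p * x + s * y) (r * x + t * y) := by
  simp only [subst, eval]; ring

theorem ext_eval {f g : BinForm} (h : ∀ x y, f.eval x y = g.eval x y) : f = g := by
  have h1 := h 1 0
  have h2 := h 0 1
  have h3 := h 1 1
  simp only [eval_one_zero, eval_zero_one, eval_one_one] at h1 h2 h3
  ext <;> linarith

theorem equivalent_iff {f g : BinForm} :
    Equivalent f g ↔ ∃ p s r t : ℤ, p * t - s * r = 1 ∧ g = f.subst p s r t := by
  constructor
  · rintro ⟨γ, hγ⟩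
    refine ⟨γ.1 0 0, γ.1 0 1, γ.1 1 0, γ.1 1 1, ?_, ext_eval fun x y => ?_⟩
    · rw [← Matrix.det_fin_two]; exact γ.2
    · rw [hγ, eval_subst]
  · rintro ⟨p, s, r, t, hd, rfl⟩
    refine ⟨⟨!![p, s; r, t], by rw [Matrix.det_fin_two_of]; exact hd⟩, fun x y => ?_⟩
    rw [eval_subst]
    simp

theorem disc_subst (f : BinForm) {p s r t : ℤ} (hd : p * t - s * r = 1) :
    (f.subst p s r t).disc = f.disc := by
  have : (f.subst p s r t).disc = (p * t - s * r) ^ 2 * f.disc := by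
    simp only [subst, disc, eval]; ring
  rw [this, hd, one_pow, one_mul]

theorem subst_subst_inv (f : BinForm) {p s r t : ℤ} (hd : p * t - s * r = 1) :
    (f.subst p s r t).subst t (-s) (-r) p = f := by
  refine ext_eval fun x y => ?_
  rw [eval_subst, eval_subst]
  congr 1
  · linear_combination x * hd
  · linear_combination y * hd

theorem isPosDef_of_pos {f : BinForm} (ha : 0 < f.a) (hd : f.disc < 0) : f.IsPosDef := by
  intro x y hxy
  have h : 4 * f.a * f.eval x y = (2 * f.a * x + f.b * y) ^ 2 + -f.disc * y ^ 2 := by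
    simp only [eval, disc]; ring
  have h2 : 0 < (2 * f.a * x + f.b * y) ^ 2 + -f.disc * y ^ 2 := by
    rcases eq_or_ne y 0 with rfl | hy
    · have hx : x ≠ 0 := by simpa using hxy
      have : 2 * f.a * x ≠ 0 := by positivity
      simp only [mul_zero, add_zero, ne_eq, OfNat.ofNat_ne_zero, not_false_eq_true, zero_pow]
      positivity
    · have : 0 < -f.disc := by linarith
      positivity
  rw [← h] at h2
  exact pos_of_mul_pos_right h2 (by positivity)

/-- The reduction conditions for the theta group acting on forms with even outer coefficients
and odd positive middle coefficient. -/
structure IsThetaReduced (f : BinForm) : Prop where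
  even_a : 2 ∣ f.a
  even_c : 2 ∣ f.c
  odd_b : ¬ 2 ∣ f.b
  b_pos : 0 < f.b
  b_lt_a : f.b < 2 * f.a
  b_lt_c : f.b < 2 * f.c

/-- If |x| = |y|, both would be odd, and the odd term b x y would make the value odd. So |x| and |y|
differ by at least 1, which is what makes the inequalities strict. -/
theorem IsThetaReduced.lt_eval {f : BinForm} (hf : f.IsThetaReduced) {x y : ℤ} (hx : x ≠ 0)
    (hy : y ≠ 0) (hxy : ¬ (2 ∣ x ∧ 2 ∣ y)) (he : 2 ∣ f.eval x y) :
    f.a < f.eval x y ∧ f.c < f.eval x y := by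
  have hne : |x| ≠ |y| := by
    intro h
    have hpar : (2 ∣ x ↔ 2 ∣ y) := by rw [← dvd_abs, h, dvd_abs]
    have hx2 : ¬ 2 ∣ x := fun h1 => hxy ⟨h1, hpar.1 h1⟩
    have hy2 : ¬ 2 ∣ y := fun h1 => hxy ⟨hpar.2 h1, h1⟩
    have h1 : (2 : ℤ) ∣ f.b * x * y := by
      have e : f.b * x * y = f.eval x y - (f.a * x ^ 2 + f.c * y ^ 2) := by simp only [eval]; ring
      rw [e]
      exact dvd_sub he (dvd_add (hf.even_a.mul_right _) (hf.even_c.mul_right _))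
    rcases Int.prime_two.dvd_or_dvd h1 with h2 | h2
    · rcases Int.prime_two.dvd_or_dvd h2 with h3 | h3
      · exact hf.odd_b h3
      · exact hx2 h3
    · exact hy2 h2
  have hu : 1 ≤ |x| := Int.one_le_abs hx
  have hv : 1 ≤ |y| := Int.one_le_abs hy
  have hsq : 1 ≤ (|x| - |y|) ^ 2 := by
    have : |x| - |y| ≠ 0 := sub_ne_zero.2 hne
    have := Int.one_le_abs this
    nlinarith [sq_abs (|x| - |y|)]
  have hlow : f.a * |x| ^ 2 - f.b * (|x| * |y|) + f.c * |y| ^ 2 ≤ f.eval x y := by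
    have h1 : -(|x| * |y|) ≤ x * y := by rw [← abs_mul]; exact neg_abs_le _
    have h2 := mul_le_mul_of_nonneg_left h1 hf.b_pos.le
    simp only [eval, sq_abs]
    linarith
  generalize |x| = u at *
  generalize |y| = v at *
  have huv : 1 ≤ u * v := by nlinarith
  have ha := hf.b_lt_a
  have hc := hf.b_lt_c
  have hb := hf.b_pos
  have ha0 : 0 < f.a := by omega
  have hc0 : 0 < f.c := by omega
  -- For a ≤ c use a u² - b u v + c v² = a(u - v)² + (2a - b)uv + (c - a)v² ≥ a + 1 + (c - a); the
  -- other case is symmetric.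
  rcases le_total f.a f.c with h | h
  · have h1 : f.b * (u * v) ≤ (2 * f.a - 1) * (u * v) :=
      mul_le_mul_of_nonneg_right (by omega) (by omega)
    have h2 : f.a * 1 ≤ f.a * (u - v) ^ 2 := mul_le_mul_of_nonneg_left hsq ha0.le
    have h3 : (f.c - f.a) * 1 ≤ (f.c - f.a) * v ^ 2 :=
      mul_le_mul_of_nonneg_left (by nlinarith) (by omega)
    constructor <;> nlinarith
  · have h1 : f.b * (u * v) ≤ (2 * f.c - 1) * (u * v) :=
      mul_le_mul_of_nonneg_right (by omega) (by omega)
    have h2 : f.c * 1 ≤ f.c * (u - v) ^ 2 := mul_le_mul_of_nonneg_left hsq hc0.le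
    have h3 : (f.a - f.c) * 1 ≤ (f.a - f.c) * u ^ 2 :=
      mul_le_mul_of_nonneg_left (by nlinarith) (by omega)
    constructor <;> nlinarith

/-- The new outer coefficients are the values of `f` at the columns of the matrix, and determinant 1
keeps a column from being even. -/
theorem IsThetaReduced.max_lt {f : BinForm} (hf : f.IsThetaReduced) {p s r t : ℤ}
    (hd : p * t - s * r = 1) (hg : (f.subst p s r t).IsThetaReduced)
    (h : p * r ≠ 0 ∨ s * t ≠ 0) : max f.a f.c < max (f.subst p s r t).a (f.subst p s r t).c := by
  rcases h with h | h
  · have h1 := hf.lt_eval (x := p) (y := r) (left_ne_zero_of_mul h) (right_ne_zero_of_mul h)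
      (by rintro ⟨⟨i, rfl⟩, j, rfl⟩
          have : 2 * (i * t - s * j) = 1 := by linarith
          omega) hg.even_a
    exact (_root_.max_lt h1.1 h1.2).trans_le (le_max_left _ _)
  · have h1 := hf.lt_eval (x := s) (y := t) (left_ne_zero_of_mul h) (right_ne_zero_of_mul h)
      (by rintro ⟨⟨i, rfl⟩, j, rfl⟩
          have : 2 * (p * j - i * r) = 1 := by linarith
          omega) hg.even_c
    exact (_root_.max_lt h1.1 h1.2).trans_le (le_max_right _ _)

/-- A column without zeros would make the larger outer coefficient grow strictly in both directions.
So the matrix is diagonal, hence ±1, or antidiagonal, which is excluded because it negates the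
middle coefficient. -/
theorem IsThetaReduced.eq_of_equivalent {f g : BinForm} (hf : f.IsThetaReduced)
    (hg : g.IsThetaReduced) (h : Equivalent f g) : f = g := by
  obtain ⟨p, s, r, t, hd, rfl⟩ := equivalent_iff.1 h
  by_cases h1 : p * r ≠ 0 ∨ s * t ≠ 0
  · have hlt := hf.max_lt hd hg h1
    -- The inverse matrix has a column without zeros as well.
    have h2 : t * -r ≠ 0 ∨ -s * p ≠ 0 := by
      by_contra! hcon
      obtain ⟨ha, hb⟩ := hcon
      have ha' : t = 0 ∨ r = 0 := by simpa using ha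
      have hb' : s = 0 ∨ p = 0 := by simpa using hb
      rcases ha' with rfl | rfl <;> rcases hb' with rfl | rfl <;> simp at hd h1
    have hlt2 := hg.max_lt (p := t) (s := -s) (r := -r) (t := p) (by linarith)
      (by rw [subst_subst_inv f hd]; exact hf) h2
    rw [subst_subst_inv f hd] at hlt2
    exact absurd hlt (not_lt.2 hlt2.le)
  · push Not at h1
    obtain ⟨ha, hb⟩ := h1
    rcases mul_eq_zero.1 ha with rfl | rfl
    · have hsr : s * r = -1 := by linarith
      have hs : s ≠ 0 := by rintro rfl; simp at hsr
      have ht : t = 0 := (mul_eq_zero.1 hb).resolve_left hs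
      subst ht
      have h1 := hg.b_pos
      have h2 := hf.b_pos
      have : (f.subst 0 s r 0).b = f.b * (s * r) := by simp [subst]
      rw [this, hsr] at h1
      omega
    · have hpt : p * t = 1 := by linarith
      have ht : t ≠ 0 := by rintro rfl; simp at hpt
      have hs : s = 0 := (mul_eq_zero.1 hb).resolve_right ht
      subst hs
      refine ext_eval fun x y => ?_
      rw [eval_subst]
      rcases Int.mul_eq_one_iff_eq_one_or_neg_one.1 hpt with ⟨rfl, rfl⟩ | ⟨rfl, rfl⟩ <;>
      simp [eval]

theorem IsPosDef.subst {f : BinForm} (hf : f.IsPosDef) {p s r t : ℤ}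
    (hd : p * t - s * r = 1) : (f.subst p s r t).IsPosDef := by
  intro x y hxy
  rw [eval_subst]
  refine hf _ _ ?_
  by_contra! h
  have hx : x = 0 := by linear_combination (-x) * hd + t * h.1 - s * h.2
  have hy : y = 0 := by linear_combination (-y) * hd - r * h.1 + p * h.2
  simp [hx, hy] at hxy

/-- Discriminant 1 mod 8 makes b odd and excludes a, c both odd, which would give 5 mod 8. If just
one of them is odd, a + b + c is even and a shear puts it in the odd place. -/
theorem exists_equivalent_even {f : BinForm} {n : ℤ} (hd : f.disc = 1 - 8 * n) :
    ∃ g, Equivalent f g ∧ 2 ∣ g.a ∧ 2 ∣ g.c := by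
  have hb : f.b % 2 = 1 := by
    by_contra h
    have h0 : f.b = 2 * (f.b / 2) := by omega
    have : 4 * ((f.b / 2) ^ 2 - f.a * f.c + 2 * n) = 1 := by
      have := hd; rw [disc, h0] at this; linarith
    omega
  have hac : f.a % 2 = 0 ∨ f.c % 2 = 0 := by
    by_contra! h
    obtain ⟨i, hi⟩ : ∃ i, f.a = 2 * i + 1 := ⟨f.a / 2, by omega⟩
    obtain ⟨j, hj⟩ : ∃ j, f.c = 2 * j + 1 := ⟨f.c / 2, by omega⟩
    obtain ⟨m, hm⟩ : ∃ m, f.b = 2 * m + 1 := ⟨f.b / 2, by omega⟩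
    obtain ⟨u, hu⟩ := Int.even_mul_succ_self m
    have : 8 * (u - 2 * i * j - i - j + n) = 4 := by
      have h1 := hd
      rw [disc, hi, hj, hm] at h1
      linear_combination h1 - 4 * hu
    omega
  rcases Int.emod_two_eq_zero_or_one f.a with ha | ha
  · rcases Int.emod_two_eq_zero_or_one f.c with hc | hc
    · exact ⟨f, Equivalent.refl f, by omega, by omega⟩
    · refine ⟨f.subst 1 1 0 1, equivalent_iff.2 ⟨1, 1, 0, 1, by norm_num, rfl⟩, ?_, ?_⟩ <;>
      simp [BinForm.subst, eval] <;> omega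
  · have hc := hac.resolve_left (by omega)
    refine ⟨f.subst 1 0 1 1, equivalent_iff.2 ⟨1, 0, 1, 1, by norm_num, rfl⟩, ?_, ?_⟩ <;>
      simp [BinForm.subst, eval] <;> omega

/-- Among the equivalent forms with even outer coefficients, start from one with least leading
coefficient. -/
theorem exists_equivalent_isThetaReduced {f : BinForm} (hf : f.IsPosDef) {n : ℤ}
    (hd : f.disc = 1 - 8 * n) : ∃ g, Equivalent f g ∧ g.IsThetaReduced := by
  have hpos : ∀ g, Equivalent f g → 0 < g.a := fun g hg => by
    obtain ⟨p, s, r, t, h1, rfl⟩ := equivalent_iff.1 hg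
    rw [← eval_one_zero]
    exact hf.subst h1 1 0 (by simp)
  have hdisc : ∀ g, Equivalent f g → g.disc = 1 - 8 * n := fun g hg => by
    obtain ⟨p, s, r, t, h1, rfl⟩ := equivalent_iff.1 hg
    rw [disc_subst f h1, hd]
  classical
  have hex : ∃ m : ℕ, ∃ g, Equivalent f g ∧ 2 ∣ g.a ∧ 2 ∣ g.c ∧ g.a = m := by
    obtain ⟨g, h1, h2, h3⟩ := exists_equivalent_even hd
    exact ⟨g.a.toNat, g, h1, h2, h3, by have := hpos g h1; omega⟩
  obtain ⟨g, hfg, ha, hc, hm⟩ := Nat.find_spec hex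
  have hmin : ∀ g', Equivalent f g' → 2 ∣ g'.a → 2 ∣ g'.c → g.a ≤ g'.a := fun g' h1 h2 h3 => by
    have h4 := hpos g' h1
    have := Nat.find_min' hex ⟨g', h1, h2, h3, (Int.toNat_of_nonneg h4.le).symm⟩
    omega
  have hga := hpos g hfg
  -- Translation by an even integer keeps c even and moves b by multiples of 4a. This choice brings
  -- b into [-2a, 2a), and parity excludes the left end.
  set j := (g.b + 2 * g.a) / (4 * g.a) with hj
  set g1 := g.subst 1 (-2 * j) 0 1 with hg1
  have hgg1 : Equivalent g g1 := equivalent_iff.2 ⟨1, -2 * j, 0, 1, by ring, rfl⟩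
  have hfg1 : Equivalent f g1 := hfg.trans hgg1
  have ha1 : g1.a = g.a := by simp [hg1, BinForm.subst, eval]
  have hb1 : g1.b = (g.b + 2 * g.a) % (4 * g.a) - 2 * g.a := by
    have e : g1.b = g.b - 4 * g.a * j := by simp [hg1, BinForm.subst]; ring
    rw [e, hj, Int.emod_def]; ring
  have hc1 : 2 ∣ g1.c := by
    have e : g1.c = 2 * (2 * g.a * j ^ 2 - g.b * j) + g.c := by
      simp [hg1, BinForm.subst, eval]; ring
    rw [e]
    exact dvd_add (dvd_mul_right _ _) hc
  have hodd : ¬ 2 ∣ g1.b := by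
    rintro ⟨i, hi⟩
    have h1 := hdisc g1 hfg1
    rw [disc, hi] at h1
    have : 4 * (i ^ 2 - g1.a * g1.c + 2 * n) = 1 := by linarith
    omega
  have hlow := Int.emod_nonneg (g.b + 2 * g.a) (show 4 * g.a ≠ 0 by omega)
  have hupp := Int.emod_lt_of_pos (g.b + 2 * g.a) (show 0 < 4 * g.a by omega)
  have hb2 : -(2 * g.a) < g1.b := by
    rcases eq_or_lt_of_le (show -(2 * g.a) ≤ g1.b by omega) with h | h
    · exact absurd ⟨-g.a, by rw [← h]; ring⟩ hodd
    · exact h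
  -- The swap exchanges a and c and negates b. Minimality then yields a ≤ c, hence |b| < 2c, and the
  -- swap also repairs a negative b.
  set g2 := g1.subst 0 (-1) 1 0 with hg2
  have hg12 : Equivalent g1 g2 := equivalent_iff.2 ⟨0, -1, 1, 0, by norm_num, rfl⟩
  have e1 : g2.a = g1.c := by simp [hg2, BinForm.subst, eval]
  have e2 : g2.b = -g1.b := by simp [hg2, BinForm.subst]
  have e3 : g2.c = g1.a := by simp [hg2, BinForm.subst, eval]
  have hac : g.a ≤ g1.c := by
    rw [← e1]
    exact hmin g2 (hfg1.trans hg12) (by rwa [e1]) (by rw [e3, ha1]; exact ha)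
  rcases lt_trichotomy 0 g1.b with h | h | h
  · exact ⟨g1, hfg1, by rwa [ha1], hc1, hodd, h, by omega, by omega⟩
  · exact absurd (by rw [← h]; exact dvd_zero _) hodd
  · exact ⟨g2, hfg1.trans hg12, by rwa [e1], by rwa [e3, ha1], by rw [e2]; simpa using hodd,
      by omega, by omega, by omega⟩

/-! ### Counting classes by triples -/

/-- The reduced form with parameters `l`, `k`, `r`, the middle coefficient being `4 r + 1` or
`4 r + 3`. -/
def ofParam : ((ℕ × ℕ) × ℕ) ⊕ ((ℕ × ℕ) × ℕ) → BinForm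
  | .inl x => ⟨2 * (x.1.1 + x.2 + 1), 4 * x.2 + 1, 2 * (x.1.2 + x.2 + 1)⟩
  | .inr x => ⟨2 * (x.1.1 + x.2 + 1), 4 * x.2 + 3, 2 * (x.1.2 + x.2 + 1)⟩

/-- The number `n` for which `ofParam x` has discriminant `1 - 8 (n + 1)`. -/
def height : ((ℕ × ℕ) × ℕ) ⊕ ((ℕ × ℕ) × ℕ) → ℕ
  | .inl x => 2 * x.1.1 * x.1.2 + 2 * (x.2 + 1) * (x.1.1 + x.1.2) + 3 * x.2 + 1
  | .inr x => 2 * x.1.1 * x.1.2 + 2 * (x.2 + 1) * (x.1.1 + x.1.2) + x.2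

theorem disc_ofParam (x : ((ℕ × ℕ) × ℕ) ⊕ ((ℕ × ℕ) × ℕ)) :
    (ofParam x).disc = 1 - 8 * (height x + 1) := by
  rcases x with x | x <;> simp only [ofParam, height, disc] <;> push_cast <;> ring

theorem isThetaReduced_ofParam (x : ((ℕ × ℕ) × ℕ) ⊕ ((ℕ × ℕ) × ℕ)) :
    (ofParam x).IsThetaReduced := by
  rcases x with x | x <;> constructor <;> simp only [ofParam] <;> omega

theorem ofParam_injective : Function.Injective ofParam := by
  rintro (⟨⟨l, k⟩, r⟩ | ⟨⟨l, k⟩, r⟩) (⟨⟨l', k'⟩, r'⟩ | ⟨⟨l', k'⟩, r'⟩) h <;>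
  simp only [ofParam, BinForm.mk.injEq] at h <;>
  simp only [Sum.inl.injEq, Sum.inr.injEq, Prod.mk.injEq, reduceCtorEq] <;> omega

theorem IsThetaReduced.exists_ofParam {f : BinForm} (hf : f.IsThetaReduced) :
    ∃ x, ofParam x = f := by
  obtain ⟨⟨a, ha⟩, ⟨c, hc⟩, h1, h2, h3, h4⟩ := hf
  obtain ⟨a', b, c'⟩ := f
  simp only at ha hc h1 h2 h3 h4
  subst ha hc
  have h5 : b % 4 = 1 ∨ b % 4 = 3 := by omega
  set r := (b / 4).toNat
  rcases h5 with h | h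
  · refine ⟨.inl (((a - r - 1).toNat, (c - r - 1).toNat), r), ?_⟩
    simp only [ofParam, BinForm.mk.injEq]
    omega
  · refine ⟨.inr (((a - r - 1).toNat, (c - r - 1).toNat), r), ?_⟩
    simp only [ofParam, BinForm.mk.injEq]
    omega

end BinForm

theorem disc_posForm {n : ℕ} (f : PosForm (8 * (n + 1) - 1)) :
    f.1.disc = 1 - 8 * ((n : ℤ) + 1) := by
  rw [f.2.2]; omega

/-- Multiples of x² + y² and x² + xy + y² have discriminant -4m² and -3m²; the first is even, the
second is even or 5 mod 8, and neither is 1 mod 8. -/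
theorem FormClass.weight_eq_one {n : ℕ} (C : FormClass (8 * (n + 1) - 1)) : C.weight = 1 := by
  unfold FormClass.weight
  rw [if_neg, if_neg]
  · rintro ⟨f, -, m, hm⟩
    have h := disc_posForm f
    rw [hm, BinForm.disc] at h
    simp only at h
    rcases Int.even_or_odd' m with ⟨i, rfl | rfl⟩
    · have : 4 * (-3 * i ^ 2 + 2 * (n + 1)) = 1 := by linarith
      omega
    · obtain ⟨u, hu⟩ := Int.even_mul_succ_self i
      have : 8 * (-3 * u + (n + 1)) = 4 := by linear_combination h + 12 * hu
      omega
  · rintro ⟨f, -, m, hm⟩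
    have h := disc_posForm f
    rw [hm, BinForm.disc] at h
    simp only at h
    have : 4 * (-m ^ 2 + 2 * (n + 1)) = 1 := by linarith
    omega

/-- The class of the reduced form with given parameters. -/
def classOfParam (n : ℕ) (x : BinForm.height ⁻¹' {n}) : FormClass (8 * (n + 1) - 1) :=
  Quotient.mk (posFormSetoid _) ⟨BinForm.ofParam x.1, by
    have hd := BinForm.disc_ofParam x.1
    have hx : BinForm.height x.1 = n := x.2
    rw [hx] at hd
    have hr := BinForm.isThetaReduced_ofParam x.1
    refine ⟨BinForm.isPosDef_of_pos ?_ (by omega), by omega⟩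
    have := hr.b_pos
    have := hr.b_lt_a
    omega⟩

theorem classOfParam_bijective (n : ℕ) : Function.Bijective (classOfParam n) := by
  constructor
  · intro x y h
    have h1 : BinForm.Equivalent (BinForm.ofParam x.1) (BinForm.ofParam y.1) := Quotient.exact h
    exact Subtype.ext (BinForm.ofParam_injective
      ((BinForm.isThetaReduced_ofParam _).eq_of_equivalent
        (BinForm.isThetaReduced_ofParam _) h1))
  · intro C
    induction C using Quotient.inductionOn with | _ f
    obtain ⟨g, hfg, hg⟩ := BinForm.exists_equivalent_isThetaReduced f.2.1 (disc_posForm f)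
    obtain ⟨x, rfl⟩ := hg.exists_ofParam
    have hx : BinForm.height x = n := by
      obtain ⟨p, s, r, t, h1, h2⟩ := BinForm.equivalent_iff.1 hfg
      have h3 := BinForm.disc_ofParam x
      rw [h2, BinForm.disc_subst _ h1, disc_posForm] at h3
      omega
    exact ⟨⟨x, hx⟩, Quotient.sound hfg.symm⟩

theorem finite_height_fiber (n : ℕ) : (BinForm.height ⁻¹' {n}).Finite := by
  have hfin : Set.Finite {x : (ℕ × ℕ) × ℕ | x.1.1 ≤ n ∧ x.1.2 ≤ n ∧ x.2 ≤ n} := by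
    refine (((Set.finite_Iic n).prod (Set.finite_Iic n)).prod (Set.finite_Iic n)).subset ?_
    rintro ⟨⟨l, k⟩, r⟩ ⟨h1, h2, h3⟩
    exact ⟨⟨h1, h2⟩, h3⟩
  refine ((hfin.image Sum.inl).union (hfin.image Sum.inr)).subset ?_
  rintro (⟨⟨l, k⟩, r⟩ | ⟨⟨l, k⟩, r⟩) h
  · refine Or.inl ⟨_, ?_, rfl⟩
    have h : BinForm.height _ = n := h
    simp only [BinForm.height] at h
    refine ⟨?_, ?_, ?_⟩ <;> simp only <;> nlinarith [Nat.zero_le (l * k)]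
  · refine Or.inr ⟨_, ?_, rfl⟩
    have h : BinForm.height _ = n := h
    simp only [BinForm.height] at h
    refine ⟨?_, ?_, ?_⟩ <;> simp only <;> nlinarith [Nat.zero_le (l * k)]

theorem hurwitzH_eq_card (n : ℕ) :
    hurwitzH (8 * (n + 1) - 1) = Nat.card (BinForm.height ⁻¹' {n}) := by
  have : Finite (BinForm.height ⁻¹' {n}) := finite_height_fiber n
  have : Fintype (BinForm.height ⁻¹' {n}) := Fintype.ofFinite _
  have : Fintype (FormClass (8 * (n + 1) - 1)) :=
    Fintype.ofBijective _ (classOfParam_bijective n)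
  rw [hurwitzH, if_neg (by omega)]
  simp only [FormClass.weight_eq_one]
  rw [finsum_eq_sum_of_fintype, Nat.card_eq_of_bijective _ (classOfParam_bijective n)]
  simp

/-! ### The class number series as a Lambert-type series -/

section
variable {q : ℂ}

theorem summable_pow_add_add (hq1 : ‖q‖ < 1) :
    Summable fun x : (ℕ × ℕ) × ℕ => ‖q‖ ^ (x.1.1 + x.1.2 + x.2) := by
  have h := summable_geometric_of_lt_one (norm_nonneg q) hq1
  have h0 : (0 : ℕ → ℝ) ≤ fun n => ‖q‖ ^ n := fun n => by positivity
  have h2 := h.mul_of_nonneg h h0 h0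
  have h3 := h2.mul_of_nonneg h (fun x => by positivity) h0
  simpa only [pow_add] using h3

theorem summable_pow_height (hq1 : ‖q‖ < 1) :
    Summable fun x => q ^ (BinForm.height x + 1) := by
  refine Summable.of_norm_bounded (g := Sum.elim (fun x => ‖q‖ ^ (x.1.1 + x.1.2 + x.2))
    (fun x => ‖q‖ ^ (x.1.1 + x.1.2 + x.2))) ?_ ?_
  · exact Summable.sum _ (summable_pow_add_add hq1) (summable_pow_add_add hq1)
  · rintro (⟨⟨l, k⟩, r⟩ | ⟨⟨l, k⟩, r⟩) <;>
    · rw [norm_pow]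
      refine pow_le_pow_of_le_one (norm_nonneg q) hq1.le ?_
      simp only [BinForm.height]
      nlinarith [Nat.zero_le (l * k), Nat.zero_le (r * (l + k))]

theorem hasSum_scriptF8Term (hq1 : ‖q‖ < 1) :
    HasSum (scriptF8Term q) (∑' x, q ^ (BinForm.height x + 1)) := by
  convert! (summable_pow_height hq1).hasSum.tsum_fiberwise BinForm.height using 1
  funext n
  rw [scriptF8Term, hurwitzH_eq_card]
  have h : ∀ x : BinForm.height ⁻¹' {n}, q ^ (BinForm.height x.1 + 1) = q ^ (n + 1) := fun x => by
    rw [show BinForm.height x.1 = n from x.2]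
  simp only [h]
  rw [tsum_const, nsmul_eq_mul]
  simp

/-- The Lambert weights. -/
def lambertW (q : ℂ) (j : ℤ) : ℂ :=
  q ^ (2 * j + 1) / (1 - q ^ (2 * j + 1)) + q ^ (2 * j + 2) / (1 - q ^ (2 * j + 3))

/-- The finite theta sums `∑_{l + k = j} q^{2 l k}`. -/
def thetaT (q : ℂ) (j : ℕ) : ℂ := ∑ x ∈ Finset.HasAntidiagonal.antidiagonal j, q ^ (2 * x.1 * x.2)

/-- For fixed l, k the exponent is affine in r, with slope 2(l + k) + 3 on the first family and 2(l
+ k) + 1 on the second. The two geometric sums depend on l, k only through 2lk and l + k. -/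
theorem hasSum_thetaT_mul_lambertW (hq1 : ‖q‖ < 1) :
    HasSum (fun j : ℕ => thetaT q j * lambertW q j) (∑' x, q ^ (BinForm.height x + 1)) := by
  have hs := summable_pow_height hq1
  have hl : Summable fun x => q ^ (BinForm.height (.inl x) + 1) :=
    hs.comp_injective Sum.inl_injective
  have hr : Summable fun x => q ^ (BinForm.height (.inr x) + 1) :=
    hs.comp_injective Sum.inr_injective
  have h := hl.hasSum.add hr.hasSum
  have htot : (∑' x, q ^ (BinForm.height x + 1)) = (∑' x, q ^ (BinForm.height (.inl x) + 1)) +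
      ∑' x, q ^ (BinForm.height (.inr x) + 1) := hl.tsum_sum hr
  rw [← htot] at h
  have hfib : ∀ x : ℕ × ℕ, HasSum (fun r : ℕ => q ^ (BinForm.height (.inl (x, r)) + 1) +
      q ^ (BinForm.height (.inr (x, r)) + 1))
      (q ^ (2 * x.1 * x.2) * lambertW q ((x.1 + x.2 : ℕ) : ℤ)) := by
    rintro ⟨l, k⟩
    have g1 := (hasSum_geometric_of_norm_lt_one
      (norm_sq_lt_one (n := 2 * (l + k) + 1) hq1 (by omega))).mul_left
      (q ^ (2 * l * k) * q ^ (2 * (l + k) + 1))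
    have g2 := (hasSum_geometric_of_norm_lt_one
      (norm_sq_lt_one (n := 2 * (l + k) + 3) hq1 (by omega))).mul_left
      (q ^ (2 * l * k) * q ^ (2 * (l + k) + 2))
    convert! g2.add g1 using 1
    · funext r
      simp only [BinForm.height, ← pow_mul, ← pow_add]
      ring_nf
    · have e1 : q ^ (2 * ((l + k : ℕ) : ℤ) + 1) = q ^ (2 * (l + k) + 1) := by exact_mod_cast rfl
      have e2 : q ^ (2 * ((l + k : ℕ) : ℤ) + 2) = q ^ (2 * (l + k) + 2) := by exact_mod_cast rfl
      have e3 : q ^ (2 * ((l + k : ℕ) : ℤ) + 3) = q ^ (2 * (l + k) + 3) := by exact_mod_cast rfl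
      rw [lambertW]
      simp only [e1, e2, e3, div_eq_mul_inv]
      ring
  have h2 := h.prod_fiberwise hfib
  rw [← Finset.HasAntidiagonal.sigmaAntidiagonalEquivProd.hasSum_iff] at h2
  refine h2.sigma fun j => ?_
  convert! hasSum_fintype _ using 1
  rw [thetaT, Finset.sum_mul, ← Finset.sum_coe_sort]
  refine Finset.sum_congr rfl fun x _ => ?_
  simp only [Function.comp, Finset.HasAntidiagonal.sigmaAntidiagonalEquivProd]
  have := Finset.HasAntidiagonal.mem_antidiagonal.1 x.2
  simp [this]

theorem hasSum_scriptF8 (hq1 : ‖q‖ < 1) :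
    HasSum (fun j : ℕ => thetaT q j * lambertW q j) (scriptF8 q) := by
  rw [scriptF8, (hasSum_scriptF8Term hq1).tsum_eq]
  exact hasSum_thetaT_mul_lambertW hq1

/-! ### Finite theta sums as Appell sums -/

/-- The coefficients of the theta function. -/
def thetaCoeff (q : ℂ) (k : ℤ) : ℂ := (-1) ^ k * q ^ (2 * k ^ 2)

theorem norm_thetaCoeff (q : ℂ) (k : ℤ) : ‖thetaCoeff q k‖ = (‖q‖ ^ 2) ^ k.natAbs ^ 2 := by
  rw [thetaCoeff, norm_mul, norm_zpow, norm_neg, norm_one, one_zpow, one_mul,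
    norm_zpow_two_mul_sq]

theorem hasSum_thetaCoeff (hq0 : q ≠ 0) (hq1 : ‖q‖ < 1) :
    HasSum (thetaCoeff q) (thetaProd 1 q) := by
  simpa [thetaCoeff] using! hasSum_thetaProd hq0 hq1 one_ne_zero

theorem thetaCoeff_neg (k : ℤ) : thetaCoeff q (-k) = thetaCoeff q k := by
  rw [thetaCoeff, thetaCoeff, neg_sq, zpow_neg, ← inv_zpow, inv_neg_one]

theorem thetaCoeff_add_one (hq0 : q ≠ 0) (k : ℤ) :
    thetaCoeff q (k + 1) = -thetaCoeff q k * q ^ (4 * k + 2) := by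
  rw [thetaCoeff, thetaCoeff, show 2 * (k + 1) ^ 2 = 2 * k ^ 2 + (4 * k + 2) by ring,
    zpow_add₀ hq0, zpow_add_one₀ (by norm_num)]
  ring

/-- The Appell sums obtained from `∑_j` of the double series. -/
def appellY (q : ℂ) (j : ℤ) : ℂ := 2 * ∑' k, thetaCoeff q k * (1 + q ^ (2 * j - 4 * k))⁻¹

theorem norm_inv_one_add_zpow_le_const (hq0 : q ≠ 0) (hq1 : ‖q‖ < 1) (m : ℤ) :
    ‖(1 + q ^ m)⁻¹‖ ≤ (1 - ‖q‖)⁻¹ :=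
  (norm_inv_one_add_zpow_le hq0 hq1 _).trans
    (mul_le_of_le_one_right (inv_nonneg.2 (by linarith)) (min_le_left _ _))

theorem hasSum_appellY (hq0 : q ≠ 0) (hq1 : ‖q‖ < 1) (j : ℤ) :
    HasSum (fun k => thetaCoeff q k * (1 + q ^ (2 * j - 4 * k))⁻¹) (appellY q j / 2) := by
  have h : Summable fun k => thetaCoeff q k * (1 + q ^ (2 * j - 4 * k))⁻¹ := by
    refine Summable.of_norm_bounded
      (((summable_int_pow_sq_mul_pow (r := ‖q‖ ^ 2) (by positivity)
        (pow_lt_one₀ (norm_nonneg q) hq1 two_ne_zero) 1).mul_right (1 - ‖q‖)⁻¹)) fun k => ?_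
    rw [norm_mul, norm_thetaCoeff, one_pow, mul_one]
    exact mul_le_mul_of_nonneg_left (norm_inv_one_add_zpow_le_const hq0 hq1 _) (by positivity)
  rw [appellY, mul_div_cancel_left₀ _ two_ne_zero]
  exact h.hasSum

/-- Apply 1/(1 + u) + 1/(1 + 1/u) = 1 after k ↦ -k. -/
theorem appellY_neg (hq0 : q ≠ 0) (hq1 : ‖q‖ < 1) (j : ℤ) :
    appellY q (-j) = 2 * thetaProd 1 q - appellY q j := by
  have h1 := (Equiv.neg ℤ).hasSum_iff.2 (hasSum_appellY hq0 hq1 (-j))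
  have h2 := (hasSum_thetaCoeff hq0 hq1).sub (hasSum_appellY hq0 hq1 j)
  have : appellY q (-j) / 2 = thetaProd 1 q - appellY q j / 2 := by
    refine h1.unique ?_
    convert! h2 using 2 with k
    simp only [Function.comp, Equiv.neg_apply, thetaCoeff_neg]
    rw [show 2 * -j - 4 * -k = -(2 * j - 4 * k) by ring]
    have h3 := one_add_zpow_ne_zero hq1 (2 * j - 4 * k)
    have h4 := one_add_zpow_ne_zero hq1 (-(2 * j - 4 * k))
    have h5 : q ^ (2 * j - 4 * k) ≠ 0 := zpow_ne_zero _ hq0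
    rw [zpow_neg] at h4 ⊢
    generalize q ^ (2 * j - 4 * k) = u at *
    have h6 : 1 + u⁻¹ = (1 + u) * u⁻¹ := by rw [add_mul, mul_inv_cancel₀ h5]; ring
    rw [h6, mul_inv, inv_inv]
    field_simp
    ring
  linear_combination 2 * this

/-- The shift k ↦ k + 1 preserves the denominator, and 1/(1 + u) = 1 - u/(1 + u) splits off the
theta series. -/
theorem appellY_add_two (hq0 : q ≠ 0) (hq1 : ‖q‖ < 1) (j : ℤ) :
    appellY q (j + 2) = 2 * thetaProd 1 q + q ^ (2 * j + 2) * appellY q j := by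
  have h1 := (Equiv.addRight (1 : ℤ)).hasSum_iff.2 (hasSum_appellY hq0 hq1 (j + 2))
  have h2 := ((Equiv.addRight (1 : ℤ)).hasSum_iff.2 (hasSum_thetaCoeff hq0 hq1)).add
    ((hasSum_appellY hq0 hq1 j).mul_left (q ^ (2 * j + 2)))
  have : appellY q (j + 2) / 2 = thetaProd 1 q + q ^ (2 * j + 2) * (appellY q j / 2) := by
    refine h1.unique ?_
    convert! h2 using 2 with k
    simp only [Function.comp, Equiv.coe_addRight, thetaCoeff_add_one hq0]
    rw [show 2 * (j + 2) - 4 * (k + 1) = 2 * j - 4 * k by ring,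
      show q ^ (2 * j + 2) = q ^ (2 * j - 4 * k) * q ^ (4 * k + 2) by
        rw [← zpow_add₀ hq0]; ring_nf]
    have h3 := one_add_zpow_ne_zero hq1 (2 * j - 4 * k)
    generalize q ^ (2 * j - 4 * k) = u at *
    generalize q ^ (4 * k + 2) = v
    field_simp
    ring
  linear_combination 2 * this

theorem appellY_zero (hq0 : q ≠ 0) (hq1 : ‖q‖ < 1) : appellY q 0 = thetaProd 1 q := by
  have := appellY_neg hq0 hq1 0
  rw [neg_zero] at this
  linear_combination this / 2

/-- At j = -1 the factor q^{2j+2} is 1, so recurrence and reflection together give Y = -Y. -/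
theorem appellY_neg_one (hq0 : q ≠ 0) (hq1 : ‖q‖ < 1) : appellY q (-1) = 0 := by
  have h1 := appellY_neg hq0 hq1 1
  have h2 := appellY_add_two hq0 hq1 (-1)
  norm_num at h2
  linear_combination (h1 - h2) / 2

theorem appellY_one (hq0 : q ≠ 0) (hq1 : ‖q‖ < 1) : appellY q 1 = 2 * thetaProd 1 q := by
  have h1 := appellY_neg hq0 hq1 1
  rw [appellY_neg_one hq0 hq1] at h1
  linear_combination h1

theorem appellY_neg_sub_two (hq0 : q ≠ 0) (hq1 : ‖q‖ < 1) (j : ℤ) :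
    appellY q (-(j + 2)) = -q ^ (2 * j + 2) * appellY q j := by
  rw [appellY_neg hq0 hq1, appellY_add_two hq0 hq1]
  ring

/-- The two end pairs contribute 1 each; inside, 2(l + 1)(k + 1) = 2lk + 2(l + k) + 2. -/
theorem thetaT_add_two (q : ℂ) (j : ℕ) :
    thetaT q (j + 2) = 2 + q ^ (2 * j + 2) * thetaT q j := by
  rw [thetaT, Finset.Nat.antidiagonal_succ_succ', thetaT, Finset.mul_sum]
  simp only [Finset.sum_cons, Finset.sum_map, mul_zero, pow_zero, zero_mul]
  rw [← add_assoc, one_add_one_eq_two]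
  congr 1
  refine Finset.sum_congr rfl fun x hx => ?_
  have := Finset.HasAntidiagonal.mem_antidiagonal.1 hx
  rw [← pow_add, ← this]
  congr 1
  simp only [Function.Embedding.prodMap, Function.Embedding.coeFn_mk, Prod.map,
    Nat.succ_eq_add_one]
  ring

theorem appellY_eq_mul_thetaT (hq0 : q ≠ 0) (hq1 : ‖q‖ < 1) :
    ∀ j : ℕ, appellY q j = thetaProd 1 q * thetaT q j
  | 0 => by simpa [thetaT] using appellY_zero hq0 hq1
  | 1 => by
    have : thetaT q 1 = 2 := by
      rw [thetaT, Finset.Nat.antidiagonal_succ]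
      norm_num
    rw [this, Nat.cast_one, appellY_one hq0 hq1, mul_comm]
  | j + 2 => by
    have e : q ^ (2 * (j : ℤ) + 2) = q ^ (2 * j + 2) := by exact_mod_cast rfl
    rw [Nat.cast_add, Nat.cast_ofNat, appellY_add_two hq0 hq1, thetaT_add_two,
      appellY_eq_mul_thetaT hq0 hq1 j, e]
    ring

theorem lambertW_neg_sub_two_mul (hq0 : q ≠ 0) (hq1 : ‖q‖ < 1) (j : ℤ) :
    lambertW q (-(j + 2)) * -q ^ (2 * j + 2) = lambertW q j := by
  have h1 := one_sub_zpow_ne_zero hq1 (show 2 * j + 1 ≠ 0 by omega)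
  have h2 := one_sub_zpow_ne_zero hq1 (show 2 * j + 3 ≠ 0 by omega)
  have h3 := one_sub_zpow_ne_zero hq1 (show -(2 * j + 1) ≠ 0 by omega)
  have h4 := one_sub_zpow_ne_zero hq1 (show -(2 * j + 3) ≠ 0 by omega)
  have h5 : q ^ (2 * j + 1) ≠ 0 := zpow_ne_zero _ hq0
  have h6 : q ^ (2 * j + 3) ≠ 0 := zpow_ne_zero _ hq0
  have e1 : q ^ (2 * j + 2) = q ^ (2 * j + 1) * q := by
    rw [← zpow_add_one₀ hq0]; ring_nf
  have e2 : q ^ (2 * j + 3) = q ^ (2 * j + 1) * q ^ 2 := by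
    rw [← zpow_natCast, ← zpow_add₀ hq0]; norm_num; ring_nf
  have e3 : q ^ (-(2 * j + 2)) = (q ^ (2 * j + 2))⁻¹ := zpow_neg _ _
  rw [lambertW, lambertW, show 2 * -(j + 2) + 1 = -(2 * j + 3) by ring,
    show 2 * -(j + 2) + 2 = -(2 * j + 2) by ring, show 2 * -(j + 2) + 3 = -(2 * j + 1) by ring]
  rw [zpow_neg] at h3 h4
  rw [zpow_neg, zpow_neg, zpow_neg]
  rw [e2] at h2 h4 h6 ⊢
  rw [e1]
  generalize q ^ (2 * j + 1) = x at *
  have h3' : x - 1 ≠ 0 := fun h => h1 (by linear_combination -h)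
  have h4' : x * q ^ 2 - 1 ≠ 0 := fun h => h2 (by linear_combination -h)
  field_simp
  ring

/-- The reflection j ↦ -2 - j multiplies the two factors by inverse quantities, so it fixes their
product and carries j ≥ 0 to j ≤ -2. -/
theorem hasSum_appellY_mul_lambertW (hq0 : q ≠ 0) (hq1 : ‖q‖ < 1) :
    HasSum (fun j : ℤ => appellY q j / 2 * lambertW q j) (thetaProd 1 q * scriptF8 q) := by
  have hnat : HasSum (fun j : ℕ => appellY q j / 2 * lambertW q j)
      (thetaProd 1 q / 2 * scriptF8 q) := by
    have e : (fun j : ℕ => appellY q j / 2 * lambertW q j) =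
        fun j : ℕ => thetaProd 1 q / 2 * (thetaT q j * lambertW q j) := by
      funext j
      rw [appellY_eq_mul_thetaT hq0 hq1]
      ring
    rw [e]
    exact (hasSum_scriptF8 hq1).mul_left (thetaProd 1 q / 2)
  have hneg : HasSum (fun n : ℕ => appellY q (-(n + 1)) / 2 * lambertW q (-(n + 1)))
      (thetaProd 1 q / 2 * scriptF8 q) := by
    -- `n = 0` is the fixed point j = -1 of the reflection, where the Appell sum vanishes.
    rw [← hasSum_nat_add_iff' 1]
    have e : (fun n : ℕ => appellY q (-((n + 1 : ℕ) + 1)) / 2 * lambertW q (-((n + 1 : ℕ) + 1))) =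
        fun j : ℕ => appellY q j / 2 * lambertW q j := by
      funext j
      rw [← lambertW_neg_sub_two_mul hq0 hq1 j, Nat.cast_add, Nat.cast_one, add_assoc,
        one_add_one_eq_two, appellY_neg_sub_two hq0 hq1]
      ring
    rw [e]
    simpa only [Finset.sum_range_one, Nat.cast_zero, zero_add, appellY_neg_one hq0 hq1, zero_div,
      zero_mul, sub_zero] using hnat
  have h := hnat.of_nat_of_neg_add_one (f := fun j : ℤ => appellY q j / 2 * lambertW q j) hneg
  rwa [← add_mul, add_halves] at h

/-! ### Absolute convergence of the double series -/

theorem norm_inv_one_sub_zpow_le (hq0 : q ≠ 0) (hq1 : ‖q‖ < 1) {m : ℤ} (hm : m ≠ 0) :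
    ‖(1 - q ^ m)⁻¹‖ ≤ (1 - ‖q‖)⁻¹ * min 1 (‖q‖ ^ (-m)) := by
  have hpos := norm_pos_iff.2 hq0
  rw [sub_eq_add_neg]
  rcases hm.lt_or_gt with h | h
  · have hle : ‖q‖ ^ (-m) ≤ ‖q‖ := by
      simpa using zpow_le_zpow_right_of_le_one₀ hpos hq1.le (show (1 : ℤ) ≤ -m by omega)
    have := norm_inv_one_add_le' (w := -q ^ m) hq1 (neg_ne_zero.2 (zpow_ne_zero _ hq0))
      (by rw [norm_neg, norm_zpow, ← zpow_neg]; exact hle)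
    rw [min_eq_right (hle.trans hq1.le), mul_comm]
    rwa [norm_neg, norm_zpow, ← zpow_neg] at this
  · have hle : ‖q‖ ^ m ≤ ‖q‖ := by
      simpa using zpow_le_zpow_right_of_le_one₀ hpos hq1.le (show (1 : ℤ) ≤ m by omega)
    have h2 : (1 : ℝ) ≤ ‖q‖ ^ (-m) := by
      rw [zpow_neg]
      exact (one_le_inv₀ (zpow_pos hpos _)).2 (hle.trans hq1.le)
    rw [min_eq_left h2, mul_one]
    exact norm_inv_one_add_le hq1 (by rwa [norm_neg, norm_zpow])

theorem norm_zpow_div_one_sub_le (hq0 : q ≠ 0) (hq1 : ‖q‖ < 1) {m : ℤ} (hm : m ≠ 0) :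
    ‖q ^ m / (1 - q ^ m)‖ ≤ (1 - ‖q‖)⁻¹ * min 1 (‖q‖ ^ m) := by
  have h := norm_inv_one_sub_zpow_le hq0 hq1 (neg_ne_zero.2 hm)
  rw [neg_neg] at h
  have h0 : q ^ m ≠ 0 := zpow_ne_zero _ hq0
  have h1 := one_sub_zpow_ne_zero hq1 hm
  have h2 := one_sub_zpow_ne_zero hq1 (neg_ne_zero.2 hm)
  rw [zpow_neg] at h h2
  have e : q ^ m / (1 - q ^ m) = -(1 - (q ^ m)⁻¹)⁻¹ := by
    rw [div_eq_iff h1, ← neg_inj, ← neg_mul, neg_neg, eq_inv_mul_iff_mul_eq₀ h2]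
    field_simp
    ring
  rwa [e, norm_neg]

theorem exists_norm_lambertW_le (hq0 : q ≠ 0) (hq1 : ‖q‖ < 1) :
    ∃ C, 0 ≤ C ∧ ∀ j, ‖lambertW q j‖ ≤ C * min 1 (‖q‖ ^ (2 * j)) := by
  have hc : (0 : ℝ) ≤ (1 - ‖q‖)⁻¹ := inv_nonneg.2 (by linarith)
  have hpos := norm_pos_iff.2 hq0
  refine ⟨(1 - ‖q‖)⁻¹ * (1 + ‖q‖⁻¹), by positivity, fun j => ?_⟩
  have hmono : ∀ i : ℤ, 2 * j ≤ i → min 1 (‖q‖ ^ i) ≤ min 1 (‖q‖ ^ (2 * j)) := fun i hi =>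
    min_le_min_left _ (zpow_le_zpow_right_of_le_one₀ hpos hq1.le hi)
  have e : lambertW q j = q ^ (2 * j + 1) / (1 - q ^ (2 * j + 1)) +
      q⁻¹ * (q ^ (2 * j + 3) / (1 - q ^ (2 * j + 3))) := by
    have : q ^ (2 * j + 2) = q⁻¹ * q ^ (2 * j + 3) := by
      rw [← zpow_neg_one, ← zpow_add₀ hq0]; ring_nf
    rw [lambertW, this]
    ring
  have b1 := (norm_zpow_div_one_sub_le hq0 hq1 (show 2 * j + 1 ≠ 0 by omega)).trans
    (mul_le_mul_of_nonneg_left (hmono _ (by omega)) hc)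
  have b2 := (norm_zpow_div_one_sub_le hq0 hq1 (show 2 * j + 3 ≠ 0 by omega)).trans
    (mul_le_mul_of_nonneg_left (hmono _ (by omega)) hc)
  rw [e]
  refine (norm_add_le _ _).trans ?_
  rw [norm_mul, norm_inv]
  have b3 := mul_le_mul_of_nonneg_left b2 (inv_nonneg.2 hpos.le)
  linarith

/-- One factor decays as j → ∞, the other as j → -∞. The loss r^{-4|k|} is later absorbed by the
Gaussian factor in k. -/
theorem min_mul_min_le {r : ℝ} (hr0 : 0 < r) (hr1 : r < 1) (j k : ℤ) :
    min 1 (r ^ (2 * j)) * min 1 (r ^ (-(2 * j - 4 * k))) ≤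
      (r ^ 2) ^ j.natAbs * (r⁻¹ ^ 4) ^ k.natAbs := by
  have h1 : ∀ i : ℤ, 0 ≤ min 1 (r ^ i) := fun i => le_min zero_le_one (zpow_nonneg hr0.le _)
  have hk : 1 ≤ (r⁻¹ ^ 4) ^ k.natAbs :=
    one_le_pow₀ (one_le_pow₀ ((one_le_inv₀ hr0).2 hr1.le))
  rcases le_total 0 j with hj | hj
  · have e : r ^ (2 * j) = (r ^ 2) ^ j.natAbs := by
      rw [← pow_mul, ← zpow_natCast]; congr 1; push_cast; rw [abs_of_nonneg hj]
    rw [← e]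
    exact mul_le_mul (min_le_right _ _) ((min_le_left _ _).trans hk) (h1 _)
      (zpow_nonneg hr0.le _)
  · refine (mul_le_of_le_one_left (h1 _) (min_le_left _ _)).trans ((min_le_right _ _).trans ?_)
    have e : (r ^ 2) ^ j.natAbs * (r⁻¹ ^ 4) ^ k.natAbs = r ^ (2 * |j| - 4 * |k|) := by
      rw [inv_pow, inv_pow, ← pow_mul, ← pow_mul, ← zpow_natCast, ← zpow_natCast, ← zpow_neg,
        ← zpow_add₀ hr0.ne']
      congr 1
      push_cast
      ring
    rw [e]
    refine zpow_le_zpow_right_of_le_one₀ hr0 hr1.le ?_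
    have := neg_abs_le k
    rw [abs_of_nonpos hj]
    linarith

theorem summable_pow_natAbs {r : ℝ} (h0 : 0 ≤ r) (h1 : r < 1) :
    Summable fun j : ℤ => r ^ j.natAbs :=
  Summable.of_nat_of_neg (by simpa using summable_geometric_of_lt_one h0 h1)
    (by simpa using summable_geometric_of_lt_one h0 h1)

theorem summable_double (hq0 : q ≠ 0) (hq1 : ‖q‖ < 1) :
    Summable fun x : ℤ × ℤ =>
      thetaCoeff q x.2 * (1 + q ^ (2 * x.1 - 4 * x.2))⁻¹ * lambertW q x.1 := by
  obtain ⟨C, hC0, hC⟩ := exists_norm_lambertW_le hq0 hq1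
  have hpos := norm_pos_iff.2 hq0
  have hr0 : 0 ≤ ‖q‖ ^ 2 := by positivity
  have hr1 := pow_lt_one₀ (norm_nonneg q) hq1 two_ne_zero
  have hc : (0 : ℝ) ≤ (1 - ‖q‖)⁻¹ := inv_nonneg.2 (by linarith)
  refine Summable.of_norm_bounded
    (((summable_pow_natAbs hr0 hr1).mul_of_nonneg
      (summable_int_pow_sq_mul_pow hr0 hr1 (‖q‖⁻¹ ^ 4)) (fun j => by positivity)
      (fun k => by positivity)).mul_left ((1 - ‖q‖)⁻¹ * C)) ?_
  rintro ⟨j, k⟩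
  simp only
  rw [norm_mul, norm_mul, norm_thetaCoeff]
  have b1 := norm_inv_one_add_zpow_le hq0 hq1 (2 * j - 4 * k)
  have b2 := hC j
  have b3 := min_mul_min_le hpos hq1 j k
  have h1 : ∀ i : ℤ, 0 ≤ min 1 (‖q‖ ^ i) := fun i => le_min zero_le_one (zpow_nonneg hpos.le _)
  calc (‖q‖ ^ 2) ^ k.natAbs ^ 2 * ‖(1 + q ^ (2 * j - 4 * k))⁻¹‖ * ‖lambertW q j‖
      ≤ (‖q‖ ^ 2) ^ k.natAbs ^ 2 * ((1 - ‖q‖)⁻¹ * min 1 (‖q‖ ^ (-(2 * j - 4 * k)))) *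
        (C * min 1 (‖q‖ ^ (2 * j))) := by gcongr
    _ = (1 - ‖q‖)⁻¹ * C * (‖q‖ ^ 2) ^ k.natAbs ^ 2 *
        (min 1 (‖q‖ ^ (2 * j)) * min 1 (‖q‖ ^ (-(2 * j - 4 * k)))) := by ring
    _ ≤ (1 - ‖q‖)⁻¹ * C * (‖q‖ ^ 2) ^ k.natAbs ^ 2 *
        ((‖q‖ ^ 2) ^ j.natAbs * (‖q‖⁻¹ ^ 4) ^ k.natAbs) := by gcongr
    _ = _ := by ring

/-! ### Regularized sums and partial fractions -/

/-- The regularized terms of `∑_j 1 / (1 - c q^{2j})`. -/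
def rhoTerm (q c : ℂ) (j : ℤ) : ℂ := (1 - c * q ^ (2 * j))⁻¹ - if 0 ≤ j then 1 else 0

/-- Passing from c to cq² shifts j by one, and the cutoff at j = 0 then differs at the single index
j = -1. -/
theorem hasSum_rhoTerm_mul_sq (hq0 : q ≠ 0) {c s : ℂ} :
    HasSum (rhoTerm q (c * q ^ 2)) (s + 1) ↔ HasSum (rhoTerm q c) s := by
  have h1 : HasSum (fun j : ℤ => if j = -1 then (1 : ℂ) else 0) 1 := hasSum_ite_eq _ _
  have e : rhoTerm q (c * q ^ 2) = fun j : ℤ =>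
      (rhoTerm q c ∘ Equiv.addRight (1 : ℤ)) j + if j = -1 then (1 : ℂ) else 0 := by
    funext j
    have e2 : c * q ^ 2 * q ^ (2 * j) = c * q ^ (2 * (j + 1)) := by
      rw [mul_add, zpow_add₀ hq0, mul_one]
      norm_cast
      ring
    rw [show (rhoTerm q c ∘ Equiv.addRight (1 : ℤ)) j = rhoTerm q c (j + 1) from rfl]
    simp only [rhoTerm, e2]
    rcases lt_trichotomy j (-1) with h | rfl | h
    · rw [if_neg (by omega), if_neg (by omega), if_neg (by omega)]; ring
    · norm_num
    · rw [if_pos (show 0 ≤ j by omega), if_pos (by omega), if_neg (by omega)]; ring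
  constructor
  · intro h
    rw [← (Equiv.addRight (1 : ℤ)).hasSum_iff]
    have h2 := h.sub h1
    rw [e, add_sub_cancel_right] at h2
    simpa using! h2
  · intro h
    rw [e]
    exact ((Equiv.addRight (1 : ℤ)).hasSum_iff.2 h).add h1

theorem hasSum_rhoTerm_mul_zpow (hq0 : q ≠ 0) {c s : ℂ} (h : HasSum (rhoTerm q c) s) (m : ℤ) :
    HasSum (rhoTerm q (c * q ^ (2 * m))) (s + m) := by
  induction m using Int.induction_on with
  | zero => simpa using h
  | succ i ih =>
    have e : c * q ^ (2 * ((i : ℤ) + 1)) = c * q ^ (2 * (i : ℤ)) * q ^ 2 := by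
      rw [mul_add, zpow_add₀ hq0, mul_one, mul_assoc]; norm_cast
    have e2 : s + ((i + 1 : ℤ) : ℂ) = s + (i : ℤ) + 1 := by push_cast; ring
    rw [e, e2]
    exact (hasSum_rhoTerm_mul_sq hq0).2 ih
  | pred i ih =>
    have e : c * q ^ (2 * (-(i : ℤ) - 1)) * q ^ 2 = c * q ^ (2 * -(i : ℤ)) := by
      rw [mul_sub, mul_one, mul_assoc, ← zpow_natCast, ← zpow_add₀ hq0]; norm_num
    have e2 : s + ((-i - 1 : ℤ) : ℂ) + 1 = s + (-i : ℤ) := by push_cast; ring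
    refine (hasSum_rhoTerm_mul_sq hq0).1 ?_
    rw [e, e2]
    exact ih

theorem summable_zpow_div_one_sub (hq0 : q ≠ 0) (hq1 : ‖q‖ < 1) :
    Summable fun n : ℕ => q ^ (2 * (n : ℤ) + 1) / (1 - q ^ (2 * (n : ℤ) + 1)) := by
  have hc : (0 : ℝ) ≤ (1 - ‖q‖)⁻¹ := inv_nonneg.2 (by linarith)
  refine Summable.of_norm_bounded
    ((summable_geometric_of_lt_one (norm_nonneg q) hq1).mul_left (1 - ‖q‖)⁻¹) fun n => ?_
  refine (norm_zpow_div_one_sub_le hq0 hq1 (by omega)).trans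
    (mul_le_mul_of_nonneg_left ((min_le_right _ _).trans ?_) hc)
  rw [← zpow_natCast]
  exact zpow_le_zpow_right_of_le_one₀ (norm_pos_iff.2 hq0) hq1.le (by omega)

/-- The terms at j = n and j = -(n + 1) cancel, as the exponents 2j + 1 are opposite. -/
theorem hasSum_rhoTerm_self (hq0 : q ≠ 0) (hq1 : ‖q‖ < 1) : HasSum (rhoTerm q q) 0 := by
  have hs := (summable_zpow_div_one_sub hq0 hq1).hasSum
  have e1 : ∀ n : ℕ, rhoTerm q q n = q ^ (2 * (n : ℤ) + 1) / (1 - q ^ (2 * (n : ℤ) + 1)) := by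
    intro n
    have h := one_sub_zpow_ne_zero hq1 (show 2 * (n : ℤ) + 1 ≠ 0 by omega)
    rw [rhoTerm, if_pos (by omega), mul_comm q, ← zpow_add_one₀ hq0]
    field_simp
    ring
  have e2 : ∀ n : ℕ, rhoTerm q q (-(n + 1)) =
      -(q ^ (2 * (n : ℤ) + 1) / (1 - q ^ (2 * (n : ℤ) + 1))) := by
    intro n
    have h := one_sub_zpow_ne_zero hq1 (show 2 * (n : ℤ) + 1 ≠ 0 by omega)
    have h2 := one_sub_zpow_ne_zero hq1 (show -(2 * (n : ℤ) + 1) ≠ 0 by omega)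
    have h0 : q ^ (2 * (n : ℤ) + 1) ≠ 0 := zpow_ne_zero _ hq0
    rw [rhoTerm, if_neg (by omega), mul_comm q, ← zpow_add_one₀ hq0,
      show 2 * (-((n : ℤ) + 1)) + 1 = -(2 * n + 1) by ring, sub_zero]
    rw [zpow_neg] at h2 ⊢
    generalize q ^ (2 * (n : ℤ) + 1) = u at *
    rw [inv_eq_iff_eq_inv, inv_neg, inv_div]
    field_simp
    ring
  have := HasSum.of_nat_of_neg_add_one (f := rhoTerm q q) (by simpa only [e1] using hs)
    (by simpa only [e2] using hs.neg)
  rwa [add_neg_cancel] at this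

/-- The terms at j and -j cancel for j ≠ 0; the term at j = 0 is 1/2 - 1. -/
theorem hasSum_rhoTerm_neg_one (hq0 : q ≠ 0) (hq1 : ‖q‖ < 1) :
    HasSum (rhoTerm q (-1)) (-1 / 2) := by
  have e1 : ∀ n : ℕ, rhoTerm q (-1) n = (1 + q ^ (2 * (n : ℤ)))⁻¹ - 1 := by
    intro n
    rw [rhoTerm, if_pos (by omega), neg_one_mul, sub_neg_eq_add]
  have e2 : ∀ n : ℕ, rhoTerm q (-1) (-(n + 1)) = -rhoTerm q (-1) (n + 1 : ℕ) := by
    intro n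
    rw [e1, rhoTerm, if_neg (by omega), neg_one_mul, sub_neg_eq_add, sub_zero, mul_neg, zpow_neg]
    push_cast
    have h := one_add_zpow_ne_zero hq1 (2 * ((n : ℤ) + 1))
    have h0 : q ^ (2 * ((n : ℤ) + 1)) ≠ 0 := zpow_ne_zero _ hq0
    generalize q ^ (2 * ((n : ℤ) + 1)) = u at *
    have h6 : 1 + u⁻¹ = (1 + u) * u⁻¹ := by rw [add_mul, mul_inv_cancel₀ h0]; ring
    rw [h6, mul_inv, inv_inv]
    field_simp
    ring
  have hs : Summable fun n : ℕ => rhoTerm q (-1) n := by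
    have hc : (0 : ℝ) ≤ (1 - ‖q‖)⁻¹ := inv_nonneg.2 (by linarith)
    refine Summable.of_norm_bounded
      ((summable_geometric_of_lt_one (norm_nonneg q) hq1).mul_left (1 - ‖q‖)⁻¹) fun n => ?_
    have h := one_add_zpow_ne_zero hq1 (2 * (n : ℤ))
    have e : rhoTerm q (-1) n = -(q ^ (2 * (n : ℤ)) * (1 + q ^ (2 * (n : ℤ)))⁻¹) := by
      rw [e1]; field_simp; ring
    rw [e, norm_neg, norm_mul, mul_comm]
    refine mul_le_mul (norm_inv_one_add_zpow_le_const hq0 hq1 _) ?_ (norm_nonneg _) hc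
    rw [norm_zpow, ← zpow_natCast]
    exact zpow_le_zpow_right_of_le_one₀ (norm_pos_iff.2 hq0) hq1.le (by omega)
  have h1 := hs.hasSum
  have h2 := ((hasSum_nat_add_iff' 1).2 h1).neg
  have := HasSum.of_nat_of_neg_add_one (f := rhoTerm q (-1)) h1 (by simpa only [e2] using h2)
  convert! this using 1
  simp only [Finset.sum_range_one, e1]
  norm_num

/-- Partial fractions in q^{2j}. Only differences of regularized terms occur, so the cutoffs cancel.
-/
theorem inv_mul_lambertW (hq0 : q ≠ 0) (hq1 : ‖q‖ < 1) (j k : ℤ) :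
    (1 + q ^ (2 * j - 4 * k))⁻¹ * lambertW q j =
      q ^ (4 * k + 1) * (1 + q ^ (4 * k + 1))⁻¹ *
          (rhoTerm q q j - rhoTerm q (-1 * q ^ (2 * (-2 * k))) j) +
        q ^ (4 * k + 2) * (1 + q ^ (4 * k + 3))⁻¹ *
          (rhoTerm q (q * q ^ 2) j - rhoTerm q (-1 * q ^ (2 * (-2 * k))) j) := by
  have h1 := one_sub_zpow_ne_zero hq1 (show 2 * j + 1 ≠ 0 by omega)
  have h2 := one_sub_zpow_ne_zero hq1 (show 2 * j + 3 ≠ 0 by omega)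
  have h3 := one_add_zpow_ne_zero hq1 (2 * j - 4 * k)
  have h4 := one_add_zpow_ne_zero hq1 (4 * k + 1)
  have h5 := one_add_zpow_ne_zero hq1 (4 * k + 3)
  have e1 : q ^ (2 * j + 1) = q ^ (2 * j - 4 * k) * q ^ (4 * k) * q := by
    rw [← zpow_add₀ hq0, ← zpow_add_one₀ hq0]; ring_nf
  have e2 : q ^ (2 * j + 3) = q ^ (2 * j - 4 * k) * q ^ (4 * k) * q ^ 3 := by
    rw [← zpow_natCast, ← zpow_add₀ hq0, ← zpow_add₀ hq0]; norm_num
  have e3 : q ^ (4 * k + 1) = q ^ (4 * k) * q := zpow_add_one₀ hq0 _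
  have e4 : q ^ (4 * k + 3) = q ^ (4 * k) * q ^ 3 := by
    rw [← zpow_natCast, ← zpow_add₀ hq0]; norm_num
  have e5 : q ^ (4 * k + 2) = q ^ (4 * k) * q ^ 2 := by
    rw [← zpow_natCast, ← zpow_add₀ hq0]; norm_num
  have e6 : q ^ (2 * j + 2) = q ^ (2 * j - 4 * k) * q ^ (4 * k) * q ^ 2 := by
    rw [← zpow_natCast, ← zpow_add₀ hq0, ← zpow_add₀ hq0]; norm_num
  have e7 : q * q ^ (2 * j) = q ^ (2 * j - 4 * k) * q ^ (4 * k) * q := by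
    rw [← e1, zpow_add_one₀ hq0, mul_comm]
  have e8 : q * q ^ 2 * q ^ (2 * j) = q ^ (2 * j - 4 * k) * q ^ (4 * k) * q ^ 3 := by
    linear_combination q ^ 2 * e7
  have e9 : 1 - -1 * q ^ (2 * (-2 * k)) * q ^ (2 * j) = 1 + q ^ (2 * j - 4 * k) := by
    rw [mul_assoc, ← zpow_add₀ hq0, show 2 * (-2 * k) + 2 * j = 2 * j - 4 * k by ring]
    ring
  rw [rhoTerm, rhoTerm, rhoTerm, lambertW, e9, e8, e7]
  rw [e1] at h1 ⊢
  rw [e2] at h2 ⊢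
  rw [e3] at h4 ⊢
  rw [e4] at h5 ⊢
  rw [e5, e6]
  generalize q ^ (2 * j - 4 * k) = x at *
  generalize q ^ (4 * k) = y at *
  generalize (if 0 ≤ j then (1 : ℂ) else 0) = w
  field_simp
  ring

theorem hasSum_inv_mul_lambertW (hq0 : q ≠ 0) (hq1 : ‖q‖ < 1) (k : ℤ) :
    HasSum (fun j : ℤ => (1 + q ^ (2 * j - 4 * k))⁻¹ * lambertW q j)
      (q ^ (4 * k + 1) * (1 + q ^ (4 * k + 1))⁻¹ * ((4 * k + 1) / 2) +
        q ^ (4 * k + 2) * (1 + q ^ (4 * k + 3))⁻¹ * ((4 * k + 3) / 2)) := by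
  have h1 := hasSum_rhoTerm_self hq0 hq1
  have h2 := (hasSum_rhoTerm_mul_sq hq0).2 h1
  have h3 := hasSum_rhoTerm_mul_zpow hq0 (hasSum_rhoTerm_neg_one hq0 hq1) (-2 * k)
  have h := ((h1.sub h3).mul_left (q ^ (4 * k + 1) * (1 + q ^ (4 * k + 1))⁻¹)).add
    ((h2.sub h3).mul_left (q ^ (4 * k + 2) * (1 + q ^ (4 * k + 3))⁻¹))
  simp only [← inv_mul_lambertW hq0 hq1] at h
  convert! h using 1
  push_cast
  ring

/-! ### The bilateral series at z = 1 -/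

/-- The terms of the bilateral series at `z = 1`. -/
def derivTerm (q : ℂ) (k : ℤ) : ℂ :=
  (-1 : ℂ) ^ (k - 1) * (4 * (k : ℂ) - 1) * q ^ (2 * k ^ 2) / (1 + q ^ (4 * k - 1))

theorem thetaCoeff_mul_eq (hq0 : q ≠ 0) (hq1 : ‖q‖ < 1) (k : ℤ) :
    thetaCoeff q k * (q ^ (4 * k + 1) * (1 + q ^ (4 * k + 1))⁻¹ * ((4 * k + 1) / 2) +
        q ^ (4 * k + 2) * (1 + q ^ (4 * k + 3))⁻¹ * ((4 * k + 3) / 2)) =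
      (derivTerm q (-k) + derivTerm q (k + 1)) / 2 := by
  have hd : ∀ m : ℤ, derivTerm q m = -thetaCoeff q m * (4 * m - 1) * (1 + q ^ (4 * m - 1))⁻¹ := by
    intro m
    rw [derivTerm, thetaCoeff, zpow_sub_one₀ (by norm_num), inv_neg_one]
    ring
  rw [hd, hd, thetaCoeff_neg, thetaCoeff_add_one hq0, show 4 * (k + 1) - 1 = 4 * k + 3 by ring,
    show 4 * -k - 1 = -(4 * k + 1) by ring, zpow_neg]
  have h := one_add_zpow_ne_zero hq1 (4 * k + 1)
  have h0 : q ^ (4 * k + 1) ≠ 0 := zpow_ne_zero _ hq0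
  generalize q ^ (4 * k + 1) = u at *
  have h6 : 1 + u⁻¹ = (1 + u) * u⁻¹ := by rw [add_mul, mul_inv_cancel₀ h0]; ring
  rw [h6, mul_inv, inv_inv]
  push_cast
  ring

/-- Both orders of summation of the double series are compared. Since k ↦ -k and k ↦ k + 1 permute
ℤ, the average in `thetaCoeff_mul_eq` sums to the full series. -/
theorem hasSum_derivTerm (hq0 : q ≠ 0) (hq1 : ‖q‖ < 1) (hs : Summable (derivTerm q)) :
    HasSum (derivTerm q) (thetaProd 1 q * scriptF8 q) := by
  have hd := (summable_double hq0 hq1).hasSum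
  have h1 := hd.prod_fiberwise fun j => (hasSum_appellY hq0 hq1 j).mul_right (lambertW q j)
  have hd2 := (Equiv.prodComm ℤ ℤ).hasSum_iff.2 hd
  have h2 := hd2.prod_fiberwise (g := fun k => (derivTerm q (-k) + derivTerm q (k + 1)) / 2)
    fun k => by
      rw [← thetaCoeff_mul_eq hq0 hq1]
      simpa only [mul_assoc] using! (hasSum_inv_mul_lambertW hq0 hq1 k).mul_left (thetaCoeff q k)
  have h3 := (((Equiv.neg ℤ).hasSum_iff.2 hs.hasSum).add
    ((Equiv.addRight (1 : ℤ)).hasSum_iff.2 hs.hasSum)).div_const 2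
  have h4 : ∑' k, derivTerm q k = thetaProd 1 q * scriptF8 q := by
    rw [(hasSum_appellY_mul_lambertW hq0 hq1).unique h1, h2.unique h3]
    ring
  rw [← h4]
  exact hs.hasSum

theorem deriv_appellTerm_one (q : ℂ) (k : ℤ) : deriv (appellTerm q k) 1 = -derivTerm q k := by
  have h1 := hasDerivAt_zpow (1 - 2 * k) (1 : ℂ) (Or.inl one_ne_zero)
  have h2 := hasDerivAt_zpow (2 * k) (1 : ℂ) (Or.inl one_ne_zero)
  have h := ((h1.sub h2).const_mul
    ((-1) ^ (k - 1) * q ^ (2 * k ^ 2) / (1 + q ^ (4 * k - 1)))).deriv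
  refine Eq.trans h ?_
  rw [derivTerm, one_zpow, one_zpow]
  push_cast
  ring

/-- Differentiate `one_sub_mul_thetaF8` at z = 1; the left side has derivative `-thetaF8 q 1`. This
also supplies the summability that `hasSum_derivTerm` assumes. -/
theorem hasSum_derivTerm_thetaF8 (hq0 : q ≠ 0) (hq1 : ‖q‖ < 1) :
    HasSum (derivTerm q) (thetaF8 q 1) := by
  have h := Complex.hasSum_deriv_of_summable_norm
    (summable_appellBound hq1 (max ‖(1 : ℂ)‖ ‖(1 : ℂ)⁻¹‖ + 1))
    (fun k => differentiableOn_appellTerm (q := q) k _) (isOpen_annulus _)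
    (fun k w hw => norm_appellTerm_le hq0 hq1 hw.1 hw.2.1.le (by simpa using hw.2.2.le) k)
    (mem_annulus one_ne_zero)
  have hd : HasDerivAt (fun z => (1 - z) * thetaF8 q z) (-thetaF8 q 1) 1 := by
    have h1 : HasDerivAt (fun z : ℂ => 1 - z) (-1) 1 := by
      simpa using (hasDerivAt_id (1 : ℂ)).const_sub 1
    have h2 := h1.mul (differentiableAt_thetaF8 hq1 one_ne_zero).hasDerivAt
    simpa using! h2
  have he : (fun z => (1 - z) * thetaF8 q z) =ᶠ[𝓝 1] fun z => ∑' k, appellTerm q k z := by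
    filter_upwards [isOpen_compl_singleton.mem_nhds (one_ne_zero (α := ℂ))] with z hz
    exact one_sub_mul_thetaF8 hq0 hq1 hz
  rw [(hd.congr_of_eventuallyEq he.symm).deriv] at h
  simp only [deriv_appellTerm_one] at h
  simpa using h.neg

/-- The annulus |q| < |z| < 1/|q| contains no odd power of q. -/
theorem eventually_ne_odd_zpow (hq0 : q ≠ 0) (hq1 : ‖q‖ < 1) :
    ∀ᶠ z in 𝓝 (1 : ℂ), z ≠ 0 ∧ ∀ m : ℤ, z ≠ q ^ (2 * m + 1) := by
  have hpos := norm_pos_iff.2 hq0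
  have h1 : ∀ᶠ z in 𝓝 (1 : ℂ), ‖q‖ < ‖z‖ :=
    continuous_norm.continuousAt.eventually (lt_mem_nhds (by simpa using hq1))
  have h2 : ∀ᶠ z in 𝓝 (1 : ℂ), ‖z‖ < ‖q‖⁻¹ :=
    continuous_norm.continuousAt.eventually
      (gt_mem_nhds (by simpa using (one_lt_inv₀ hpos).2 hq1))
  filter_upwards [h1, h2] with z h1 h2
  refine ⟨norm_pos_iff.1 (hpos.trans h1), ?_⟩
  rintro m rfl
  rw [norm_zpow] at h1 h2
  rcases le_or_gt 0 m with h | h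
  · refine h1.not_ge ?_
    simpa using zpow_le_zpow_right_of_le_one₀ hpos hq1.le (show (1 : ℤ) ≤ 2 * m + 1 by omega)
  · refine h2.not_ge ?_
    simpa using zpow_le_zpow_right_of_le_one₀ hpos hq1.le (show 2 * m + 1 ≤ (-1 : ℤ) by omega)

theorem tendsto_thetaProd_mul_F8 (hq0 : q ≠ 0) (hq1 : ‖q‖ < 1) :
    Tendsto (fun z : ℂ => thetaProd z q * F8 z q) (𝓝[≠] 1) (𝓝 (thetaF8 q 1)) := by
  refine ((differentiableAt_thetaF8 hq1 one_ne_zero).continuousAt.tendsto.mono_left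
    nhdsWithin_le_nhds).congr' ?_
  filter_upwards [nhdsWithin_le_nhds (eventually_ne_odd_zpow hq0 hq1)] with z hz
  exact thetaF8_eq hq1 hz.1 hz.2

theorem thetaProd_one (hq1 : ‖q‖ < 1) : thetaProd 1 q = qJ 2 q ^ 2 / qJ 4 q := by
  have hp := norm_sq_lt_one hq1 two_ne_zero
  have h := qPochInf_even_odd (q ^ 2) hp
  have e : (q ^ 2) ^ 2 = q ^ 4 := by ring
  have e2 : q ^ 2 * q ^ 2 = q ^ 4 := by ring
  rw [e, e2] at h
  have h4 : qPochInf (q ^ 4) (q ^ 4) ≠ 0 :=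
    qPochInf_self_ne_zero (norm_sq_lt_one hq1 (by norm_num))
  rw [qJ, qJ, thetaProd, h, one_pow, one_mul, div_one]
  field_simp

theorem thetaF8_one (hq0 : q ≠ 0) (hq1 : ‖q‖ < 1) :
    thetaF8 q 1 = qJ 2 q ^ 2 / qJ 4 q * scriptF8 q := by
  have h := hasSum_derivTerm_thetaF8 hq0 hq1
  rw [← thetaProd_one hq1]
  exact h.unique (hasSum_derivTerm hq0 hq1 h.summable)

end

end

theorem mainTheorem7 (q : ℂ) (hq0 : q ≠ 0) (hq1 : ‖q‖ < 1) :
    (∀ z : ℂ, z ≠ 0 → z ≠ 1 → (∀ m : ℤ, z ≠ q ^ (2 * m + 1)) →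
      Summable (F8Term z q) ∧
      HasSum
        (fun k : ℤ => (-1 : ℂ) ^ (k - 1) * q ^ (2 * k ^ 2) / (1 + q ^ (4 * k - 1)) *
          ((z ^ (1 - 2 * k) - z ^ (2 * k)) / (1 - z)))
        (thetaProd z q * F8 z q)) ∧
    (Summable (scriptF8Term q) ∧
      Tendsto (fun z : ℂ => thetaProd z q * F8 z q) (𝓝[≠] 1)
        (𝓝 (qJ 2 q ^ 2 / qJ 4 q * scriptF8 q)) ∧
      HasSum
        (fun k : ℤ => (-1 : ℂ) ^ (k - 1) * (4 * (k : ℂ) - 1) * q ^ (2 * k ^ 2) /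
          (1 + q ^ (4 * k - 1)))
        (qJ 2 q ^ 2 / qJ 4 q * scriptF8 q)) := by
  refine ⟨fun z hz0 hz1 hz => ⟨summable_F8Term hq0 hq1 hz0 hz,
    hasSum_thetaProd_mul_F8 hq0 hq1 hz0 hz1 hz⟩, (hasSum_scriptF8Term hq1).summable, ?_, ?_⟩
  · rw [← thetaF8_one hq0 hq1]
    exact tendsto_thetaProd_mul_F8 hq0 hq1
  · rw [← thetaF8_one hq0 hq1]
    exact hasSum_derivTerm_thetaF8 hq0 hq1
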